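/- **Setting.** Let $d_x,d_y,N\ge 1$, $0<\epsilon\le 1$, $\theta=\epsilon N$, $l=\min(\lceil 1/\epsilon\rceil,d_x,d_y)$, and let $(x_t,y_t)_{t\ge1}$ be a stream with $x_t\in\mathbb R^{d_x}$, $y_t\in\mathbb R^{d_y}$, $\|x_t\|_2=\|y_t\|_2=1$. For $T\ge N$ put $X_W=[x_{T-N+1},\dots,x_T]$, $Y_W=[y_{T-N+1},\dots,y_T]$. **Algorithm (SO-COD with fast updates).** A *sketch* consists of matrices $A\in\mathbb R^{d_x\times k}$, $B\in\mathbb R^{d_y\times k}$ with stored factorizations $A=Q_XR_X$, $B=Q_YR_Y$, and a queue $S$ of *snapshots*, that is, pairs of vectors $(a,b)\in\mathbb R^{d_x}\times\mathbb R^{d_y}$ with a registration time $t$ (and the registration time of the preceding snapshot). The algorithm keeps a primary and an auxiliary sketch, both empty ($k=0$) at the start. At time $i$, if $i\equiv1\pmod N$, the auxiliary sketch with its queue replaces the primary one and is reset to empty. Then each of the two sketches processes $(x_i,y_i)$ as follows. 1. Remove the snapshots with $t+N\le i$ from the head of $S$. 2. Append $x_i$ to $A$ and $y_i$ to $B$ as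 new columns. If there are now fewer than $l$ columns, update $Q_X$ by the normalized component $x'/\|x'\|$ of $x_i$ orthogonal to the columns of $Q_X$ (by a zero column if $x'=0$) and $R_X$ to $\begin{bmatrix}R_X&Q_X^\top x_i\\0&\|x'\|\end{bmatrix}$, and treat $Q_Y,R_Y$ in the same way. Otherwise *compress*: take QR decompositions $A=Q_xR_x$, $B=Q_yR_y$ and an SVD $R_xR_y^\top=U\Sigma V^\top$ (singular values in non-increasing order), let $\delta=\sigma_{\lceil l/2\rceil}(\Sigma)$ and $\hat\Sigma=\max(\Sigma-\delta I,0)$, set $A=Q_xU\hat\Sigma^{1/2}$, $B=Q_yV\hat\Sigma^{1/2}$ without the zero columns, and recompute $A=Q_XR_X$, $B=Q_YR_Y$ by QR. 3. Take an SVD $R_XR_Y^\top=U\Sigma V^\top$. For each $j$ with $\sigma_j\ge\theta$, append the snapshot $a=\sqrt{\sigma_j}\,Q_Xu_j$, $b=\sqrt{\sigma_j}\,Q_Yv_j$, $t=i$ to $S$, and subtract $Q_Xu_ju_j^\top R_X$ from $A$, $Q_Yv_jv_j^\top R_Y$ from $B$, $u_ju_j^\top R_X$ from $R_X$, and $v_jv_j^\top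 R_Y$ from $R_Y$. A query returns $A_{aug}=[A,C]$, $B_{aug}=[B,D]$, where $A,B$ are the matrices of the primary sketch and the columns of $C$ and $D$ are the vectors $a$ and $b$ of the snapshots in its queue. **Cost model.** Arithmetic operations, square roots, comparisons and moves of one word (a real number or a time stamp) cost one step; matrix products are computed by the schoolbook method; replacing one sketch by the other takes constant time. For a constant $\kappa$, a QR decomposition of a $d\times k$ matrix costs at most $\kappa dk^2$ steps and an SVD of a $k\times k$ matrix at most $\kappa k^3$ steps. Space is the number of words stored after an update. **Theorem.** For every stream the algorithm can be carried out for all times, and for every choice of the QR and singular value decompositions the following holds. (i) If $\lceil 1/\epsilon\rceil\le\min(d_x,d_y)$ (so that $l=\lceil 1/\epsilon\rceil$), then at every time $T\ge N$ the query output satisfies $$\bigl\|X_WY_W^\top-A_{aug}B_{aug}^\top\bigr\|_2\le 8\epsilon N.$$ In any case $8\epsilon N=8\epsilon\,\|X_W\|_F\|Y_W\|_F$. (ii) At every time each of the two queues holds $O(1/\epsilon)$ snapshots, $A_{aug}$ and $B_{aug}$ have $O(1/\epsilon)$ columns, and the algorithm uses $O((d_x+d_y)/\epsilon)$ space. (iii)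 For every $T$ the first $T$ updates together take $O\bigl(T\,((d_x+d_y)l+l^3)\bigr)$ steps, that is, the amortized update time is $O((d_x+d_y)l+l^3)$. The constants in the $O$-bounds depend only on $\kappa$. -/

import Mathlib

open Matrix

noncomputable section

namespace SOCOD

/-! ### Norms -/

/-- Spectral norm: the operator norm between Euclidean spaces. -/
def specNorm {m n : ℕ} (M : Matrix (Fin m) (Fin n) ℝ) : ℝ :=
  ‖LinearMap.toContinuousLinearMap (Matrix.toEuclideanLin M)‖

/-- Frobenius norm. -/
def frobNorm {m n : ℕ} (M : Matrix (Fin m) (Fin n) ℝ) : ℝ :=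
  Real.sqrt (∑ i, ∑ j, M i j ^ 2)

/-! ### Computations with a step count

A computation is the set of its possible outcomes: `c a n` says that `c` can return `a` after
exactly `n` elementary steps. One step is one arithmetic operation, square root, comparison, or
move of one word, where a word holds a real number or a time stamp. Nondeterminism occurs only
because QR and singular value decompositions are not unique, and because only an upper bound
for the number of steps of these two routines is prescribed. -/

def Comp (α : Type) : Type := α → ℕ → Prop

def Comp.Returns {α : Type} (c : Comp α) (a : α) (n : ℕ) : Prop := c a n

instance : Monad Comp where
  pure a := fun b n => b = a ∧ n = 0
  bind c f := fun b n => ∃ a n₁ n₂, c a n₁ ∧ f a b n₂ ∧ n = n₁ + n₂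

/-- Spend `n` steps. -/
def charge (n : ℕ) : Comp Unit := fun _ m => m = n

/-- Schoolbook product of an `m × k` and a `k × p` matrix. -/
def mulMat {m k p : ℕ} (A : Matrix (Fin m) (Fin k) ℝ) (B : Matrix (Fin k) (Fin p) ℝ) :
    Comp (Matrix (Fin m) (Fin p) ℝ) := do
  charge (2 * m * k * p)
  pure (A * B)

/-- Schoolbook product of an `m × k` matrix and a vector. -/
def mulVector {m k : ℕ} (A : Matrix (Fin m) (Fin k) ℝ) (v : Fin k → ℝ) :
    Comp (Fin m → ℝ) := do
  charge (2 * m * k)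
  pure (A *ᵥ v)

/-- `A = Q R` is a (thin) QR decomposition. -/
def IsQR {d k : ℕ} (A Q : Matrix (Fin d) (Fin k) ℝ) (R : Matrix (Fin k) (Fin k) ℝ) : Prop :=
  Qᵀ * Q = 1 ∧ R.BlockTriangular id ∧ A = Q * R

/-- `M = U diag(σ) Vᵀ` is a singular value decomposition of the square matrix `M`, with the
singular values in non-increasing order. -/
def IsSVD {k : ℕ} (M U : Matrix (Fin k) (Fin k) ℝ) (σ : Fin k → ℝ)
    (V : Matrix (Fin k) (Fin k) ℝ) : Prop :=
  Uᵀ * U = 1 ∧ Vᵀ * V = 1 ∧ Antitone σ ∧ (∀ i, 0 ≤ σ i) ∧ M = U * Matrix.diagonal σ * Vᵀ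

/-- A QR routine: returns some QR decomposition `(Q, R)` of a `d × k` matrix, in at most
`κ d k²` steps. -/
def qr (κ : ℕ) {d k : ℕ} (A : Matrix (Fin d) (Fin k) ℝ) :
    Comp (Matrix (Fin d) (Fin k) ℝ × Matrix (Fin k) (Fin k) ℝ) :=
  fun r n => IsQR A r.1 r.2 ∧ n ≤ κ * (d * k ^ 2)

/-- An SVD routine: returns some singular value decomposition `(U, σ, V)` of a `k × k` matrix,
in at most `κ k³` steps. -/
def svd (κ : ℕ) {k : ℕ} (M : Matrix (Fin k) (Fin k) ℝ) :
    Comp (Matrix (Fin k) (Fin k) ℝ × (Fin k → ℝ) × Matrix (Fin k) (Fin k) ℝ) :=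
  fun r n => IsSVD M r.1 r.2.1 r.2.2 ∧ n ≤ κ * k ^ 3

/-! ### The data kept by the algorithm -/

/-- A snapshot: the registered pair of vectors `a ∈ ℝ^dx`, `b ∈ ℝ^dy`, the time `t` of
registration, and the time `s` of the snapshot that preceded it in the queue. -/
structure Snapshot (dx dy : ℕ) where
  a : Fin dx → ℝ
  b : Fin dy → ℝ
  s : ℕ
  t : ℕ

/-- Sketch matrices with `k` columns and their decompositions `A = QX * RX`, `B = QY * RY`. -/
structure Factors (dx dy k : ℕ) where
  A : Matrix (Fin dx) (Fin k) ℝ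
  B : Matrix (Fin dy) (Fin k) ℝ
  QX : Matrix (Fin dx) (Fin k) ℝ
  RX : Matrix (Fin k) (Fin k) ℝ
  QY : Matrix (Fin dy) (Fin k) ℝ
  RY : Matrix (Fin k) (Fin k) ℝ

/-- A co-occurring directions sketch with `k` occupied columns (the empty columns are not
stored) together with its queue of snapshots, oldest first. -/
structure Sketch (dx dy : ℕ) where
  k : ℕ
  F : Factors dx dy k
  S : List (Snapshot dx dy)

/-- The primary and the auxiliary sketch. -/
structure State (dx dy : ℕ) where
  primary : Sketch dx dy
  aux : Sketch dx dy

def Sketch.empty (dx dy : ℕ) : Sketch dx dy := ⟨0, ⟨0, 0, 0, 0, 0, 0⟩, []⟩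

def State.init (dx dy : ℕ) : State dx dy := ⟨Sketch.empty dx dy, Sketch.empty dx dy⟩

/-- Number of words that hold a sketch: `A`, `B`, `QX`, `QY`, `RX`, `RY`, the number `k`, and
the snapshots. -/
def Sketch.words {dx dy : ℕ} (sk : Sketch dx dy) : ℕ :=
  2 * (dx + dy) * sk.k + 2 * sk.k ^ 2 + 1 + sk.S.length * (dx + dy + 2)

/-- Number of words of the whole data structure: both sketches, the parameters `dx`, `dy`, `l`,
`N`, `θ`, and the current time. -/
def State.words {dx dy : ℕ} (st : State dx dy) : ℕ :=
  st.primary.words + st.aux.words + 6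

/-! ### The update -/

/-- The matrix `[A, x]`. -/
def appendCol {d k : ℕ} (A : Matrix (Fin d) (Fin k) ℝ) (x : Fin d → ℝ) :
    Matrix (Fin d) (Fin (k + 1)) ℝ :=
  Matrix.of fun i => Fin.snoc (α := fun _ => ℝ) (A i) (x i)

/-- The block matrix with rows `[R, v]` and `[0, r]`. -/
def borderR {k : ℕ} (R : Matrix (Fin k) (Fin k) ℝ) (v : Fin k → ℝ) (r : ℝ) :
    Matrix (Fin (k + 1)) (Fin (k + 1)) ℝ :=
  Matrix.of (Fin.snoc (α := fun _ => Fin (k + 1) → ℝ)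
    (fun i => Fin.snoc (α := fun _ => ℝ) (R i) (v i))
    (Fin.snoc (α := fun _ => ℝ) (fun _ => 0) r))

/-- The first `c` columns. -/
def takeCols {d k c : ℕ} (h : c ≤ k) (A : Matrix (Fin d) (Fin k) ℝ) :
    Matrix (Fin d) (Fin c) ℝ :=
  A.submatrix id (Fin.castLE h)

/-- Incremental decomposition: from `A = Q R` to a decomposition of `[A, x]`. If `x` lies in the
span of the columns of `Q`, so that the residual `x'` is zero, then the new column of `Q` is
zero (as `0⁻¹ = 0`). -/
def incDec {d k : ℕ} (Q : Matrix (Fin d) (Fin k) ℝ) (R : Matrix (Fin k) (Fin k) ℝ)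
    (x : Fin d → ℝ) :
    Comp (Matrix (Fin d) (Fin (k + 1)) ℝ × Matrix (Fin (k + 1)) (Fin (k + 1)) ℝ) := do
  let v ← mulVector Qᵀ x
  let p ← mulVector Q v
  charge d
  let x' : Fin d → ℝ := x - p
  charge (2 * d + 1)
  let r : ℝ := Real.sqrt (∑ i, x' i ^ 2)
  charge (d + (2 * k + 1))
  pure (appendCol Q (r⁻¹ • x'), borderR R v r)

/-- The number of singular values that survive the shrinkage by `δ`. -/
def survivors {k : ℕ} (σ : Fin k → ℝ) (δ : ℝ) : ℕ :=
  (Finset.univ.filter fun i => δ < σ i).card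

theorem survivors_le {k : ℕ} (σ : Fin k → ℝ) (δ : ℝ) : survivors σ δ ≤ k :=
  (Finset.card_le_univ _).trans_eq (Fintype.card_fin k)

/-- The compression step of co-occurring directions on full sketches, with sketch size `l`:
`δ` is the singular value number `⌈l / 2⌉` (counted from one) of `A Bᵀ`, all singular values are
decreased by `δ` and truncated at zero, and the columns that vanish are emptied. The returned
number is the number of the remaining columns. -/
def compress (κ l : ℕ) {dx dy k : ℕ} (A : Matrix (Fin dx) (Fin (k + 1)) ℝ)
    (B : Matrix (Fin dy) (Fin (k + 1)) ℝ) (h : l ≤ k + 1) :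
    Comp ((c : ℕ) × Matrix (Fin dx) (Fin c) ℝ × Matrix (Fin dy) (Fin c) ℝ) := do
  let X ← qr κ A
  let Y ← qr κ B
  let M ← mulMat X.2 Y.2ᵀ
  let D ← svd κ M
  let σ : Fin (k + 1) → ℝ := D.2.1
  let δ : ℝ := σ ⟨(l - 1) / 2, by omega⟩
  charge (4 * (k + 1))
  let root : Fin (k + 1) → ℝ := fun i => Real.sqrt (max (σ i - δ) 0)
  let QU ← mulMat X.1 D.1
  let QV ← mulMat Y.1 D.2.2
  charge ((dx + dy) * (k + 1))
  pure ⟨survivors σ δ,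
    takeCols (survivors_le σ δ) (QU * Matrix.diagonal root),
    takeCols (survivors_le σ δ) (QV * Matrix.diagonal root)⟩

/-- Insert the pair `(x, y)` and bring the decompositions up to date; compress if the sketch has
become full. -/
def insert (κ l : ℕ) {dx dy : ℕ} (x : Fin dx → ℝ) (y : Fin dy → ℝ) {k : ℕ}
    (F : Factors dx dy k) : Comp ((c : ℕ) × Factors dx dy c) := do
  charge (dx + dy + 1)
  let A := appendCol F.A x
  let B := appendCol F.B y
  if h : l ≤ k + 1 then
    let r ← compress κ l A B h
    let X ← qr κ r.2.1
    let Y ← qr κ r.2.2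
    pure ⟨r.1, ⟨r.2.1, r.2.2, X.1, X.2, Y.1, Y.2⟩⟩
  else
    let X ← incDec F.QX F.RX x
    let Y ← incDec F.QY F.RY y
    pure ⟨k + 1, ⟨A, B, X.1, X.2, Y.1, Y.2⟩⟩

/-- Drop the snapshots at the head of the queue that have left the window at time `i`. -/
def expire (N i : ℕ) {dx dy : ℕ} (S : List (Snapshot dx dy)) : Comp (List (Snapshot dx dy)) := do
  let S' := S.dropWhile fun s => decide (s.t + N ≤ i)
  charge ((S.length - S'.length) + 1)
  pure S'

/-- Time stamp of the newest snapshot in the queue, `0` if there is none. -/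
def lastTime {dx dy : ℕ} (S : List (Snapshot dx dy)) : ℕ :=
  match S.getLast? with
  | some s => s.t
  | none => 0

/-- Register at time `i` the direction given by the singular triple `(σ, u, v)` of `RX RYᵀ` as a
snapshot, and remove it from the sketch. -/
def register (i : ℕ) {dx dy k : ℕ} (σ : ℝ) (u v : Fin k → ℝ)
    (p : Factors dx dy k × List (Snapshot dx dy)) :
    Comp (Factors dx dy k × List (Snapshot dx dy)) := do
  let F := p.1
  let S := p.2
  let qu ← mulVector F.QX u
  let qv ← mulVector F.QY v
  let ur ← mulVector F.RXᵀ u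
  let vr ← mulVector F.RYᵀ v
  charge (1 + (dx + dy) + (dx + dy + 2))
  let snap : Snapshot dx dy := ⟨Real.sqrt σ • qu, Real.sqrt σ • qv, lastTime S, i⟩
  charge (2 * (dx + dy) * k + 4 * k ^ 2)
  pure (⟨F.A - vecMulVec qu ur, F.B - vecMulVec qv vr,
    F.QX, F.RX - vecMulVec u ur, F.QY, F.RY - vecMulVec v vr⟩, S ++ [snap])

open Classical in
/-- Processing of the pair `(x, y)`, which arrives at time `i`, by one sketch. -/
def updateSketch (κ l N : ℕ) (θ : ℝ) (i : ℕ) {dx dy : ℕ} (x : Fin dx → ℝ) (y : Fin dy → ℝ)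
    (sk : Sketch dx dy) : Comp (Sketch dx dy) := do
  let S ← expire N i sk.S
  let G ← insert κ l x y sk.F
  let M ← mulMat G.2.RX G.2.RYᵀ
  let D ← svd κ M
  let p ← (List.finRange G.1).foldlM
    (fun p j => do
      charge 1
      if θ ≤ D.2.1 j then register i (D.2.1 j) (D.1.col j) (D.2.2.col j) p else pure p)
    (G.2, S)
  pure ⟨G.1, p.1, p.2⟩

/-- The update at time `i`: every `N` time steps the auxiliary sketch takes the place of the
primary one and is restarted; then both sketches process the new pair. -/
def update (κ l N : ℕ) (θ : ℝ) (i : ℕ) {dx dy : ℕ} (x : Fin dx → ℝ) (y : Fin dy → ℝ)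
    (st : State dx dy) : Comp (State dx dy) := do
  charge 4
  let st' := if i ≡ 1 [MOD N] then ⟨st.aux, Sketch.empty dx dy⟩ else st
  let P ← updateSketch κ l N θ i x y st'.primary
  let Q ← updateSketch κ l N θ i x y st'.aux
  pure ⟨P, Q⟩

/-- The first `T` updates, on the stream `(x 1, y 1), (x 2, y 2), …`. The step count is the total
over the `T` updates. -/
def run (κ l N : ℕ) (θ : ℝ) {dx dy : ℕ} (x : ℕ → EuclideanSpace ℝ (Fin dx))
    (y : ℕ → EuclideanSpace ℝ (Fin dy)) : ℕ → Comp (State dx dy)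
  | 0 => pure (State.init dx dy)
  | T + 1 => do
    let st ← run κ l N θ x y T
    update κ l N θ (T + 1) (fun j => x (T + 1) j) (fun j => y (T + 1) j) st

/-! ### Query and window -/

/-- Number of columns of the query output. -/
def State.augCols {dx dy : ℕ} (st : State dx dy) : ℕ := st.primary.k + st.primary.S.length

/-- `[A, C]`, where the columns of `C` are the `a`-vectors of the snapshots in the primary
queue. -/
def State.Aaug {dx dy : ℕ} (st : State dx dy) : Matrix (Fin dx) (Fin st.augCols) ℝ :=
  Matrix.of fun i => Fin.append (st.primary.F.A i) (fun j => (st.primary.S.get j).a i)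

/-- `[B, D]`, where the columns of `D` are the `b`-vectors of the snapshots in the primary
queue. -/
def State.Baug {dx dy : ℕ} (st : State dx dy) : Matrix (Fin dy) (Fin st.augCols) ℝ :=
  Matrix.of fun i => Fin.append (st.primary.F.B i) (fun j => (st.primary.S.get j).b i)

/-- The window matrix with columns `z (T - N + 1), …, z T` (for `N ≤ T`). -/
def window {d : ℕ} (z : ℕ → EuclideanSpace ℝ (Fin d)) (N T : ℕ) : Matrix (Fin d) (Fin N) ℝ :=
  Matrix.of fun i j => z (T - N + 1 + j) i

/-- The sketch size `min (⌈1/ε⌉, dx, dy)`. -/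
def sketchSize (ε : ℝ) (dx dy : ℕ) : ℕ := min ⌈1 / ε⌉₊ (min dx dy)

end SOCOD

end

/-!
The proof follows one sketch from the time at which it is started, and looks only at the product
`M = A Bᵀ`, at its spectral norm, its nuclear norm and its rank.

The stored factors stay usable: `Q` is always a partial isometry whose initial space contains the
columns of `R` (`IsFactorization`), although `Q` may have zero columns and `R` need not stay
triangular. Hence an SVD of `R_X R_Yᵀ` yields singular directions of `A Bᵀ`
(`IsFactorization.isSingularDecomp`), and every step acts on them:

* an insertion adds `x yᵀ`, hence at most `1` to the nuclear norm and to the rank;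
* a compression with shrinkage `δ` makes an error of at most `δ` in the spectral norm, lowers the
  nuclear norm by at least `l δ / 2`, and does not raise the rank (`IsSingularDecomp.shrinks`);
* a registration moves a part of `A Bᵀ` exactly into a snapshot, lowers the nuclear norm by at least
  `θ` and the rank by `1`; after all registrations `‖A Bᵀ‖ ≤ θ` (`registration_spec`).

*Accuracy and space.* A sketch lives for at most `2N` steps, so `l/2 · Σ δ + θ · #snapshots ≤ 2N`.
Therefore at most `2/ε` snapshots are registered, and `Σ δ ≤ 4εN` when `l ≥ 1/ε`. The stream from
the start up to a time `W` is the sketch at time `W`, plus the snapshots registered up to `W`, plus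
an accumulated error. The difference of this identity at the two ends of the window shows that the
query differs from the window product by the errors made inside the window and by the sketch at the
beginning of the window: at most `4εN + θ = 5εN` (`SketchInvariant.window_error`). Nuclear norms are
only ever bounded from above, and are handled through their dual description (`NuclearLE`).

*Time.* A single update may register up to `l` snapshots or compress a full sketch, each of which
exceeds the amortized bound. The potential `Sketch.potential` absorbs this: the rank grows by at most
one per insertion and drops with every registration, so it pays for the registrations, while the
number of columns is halved by a compression, and so it pays for the compressions.

*Existence of outcomes* is proved together with these bounds by a small calculus of total
correctness (`Comp.Spec`). The only place where it could fail is the QR decomposition, which needs at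
most as many columns as rows; this holds because a sketch never has more than `l ≤ min(dx, dy)`
columns.
-/

namespace SOCOD

open scoped Matrix.Norms.L2Operator

/-! ### Existence of the decompositions -/

theorem transpose_mul_self_of_orthonormal {d : ℕ} {ι : Type*} [DecidableEq ι]
    {b : ι → EuclideanSpace ℝ (Fin d)} (hb : Orthonormal ℝ b) :
    (Matrix.of fun i j => b j i)ᵀ * (Matrix.of fun i j => b j i) = 1 := by
  ext i j
  have h := (orthonormal_iff_ite.mp hb) i j
  rw [Matrix.one_apply, ← h]
  simp [Matrix.mul_apply, PiLp.inner_apply, mul_comm]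

theorem exists_isQR {d k : ℕ} (h : k ≤ d) (A : Matrix (Fin d) (Fin k) ℝ) :
    ∃ Q R, IsQR A Q R := by
  -- Gram–Schmidt needs as many vectors as dimensions: pad with zero columns.
  let f : Fin d → EuclideanSpace ℝ (Fin d) := fun j =>
    if hj : (j : ℕ) < k then WithLp.toLp 2 (A.col ⟨j, hj⟩) else 0
  let b := InnerProductSpace.gramSchmidtOrthonormalBasis (𝕜 := ℝ) (f := f) (by simp)
  have htri : ∀ {i j : Fin d}, i < j → b.repr (f i) j = 0 := fun hij =>
    InnerProductSpace.gramSchmidtOrthonormalBasis_inv_triangular' _ f hij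
  refine ⟨Matrix.of fun i j => b (Fin.castLE h j) i,
    Matrix.of fun i j => b.repr (f (Fin.castLE h j)) (Fin.castLE h i), ?_, ?_, ?_⟩
  · exact transpose_mul_self_of_orthonormal
      (b.orthonormal.comp _ (Fin.castLE_injective h))
  · intro i j hij
    exact htri (by simpa using hij)
  · ext i j
    have hf : f (Fin.castLE h j) = WithLp.toLp 2 (A.col j) := by simp [f]
    have hs := congrArg (fun v => v i) (b.sum_repr (f (Fin.castLE h j)))
    simp only [hf, WithLp.ofLp_sum, Finset.sum_apply, PiLp.smul_apply, smul_eq_mul] at hs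
    rw [Matrix.mul_apply, ← show (A.col j) i = A i j from rfl, ← hs]
    symm
    refine Fintype.sum_of_injective (Fin.castLE h) (Fin.castLE_injective h) _ _ ?_ ?_
    · intro m hm
      have hlt : Fin.castLE h j < m := by
        by_contra hc
        refine hm ⟨⟨m, lt_of_le_of_lt (show (m : ℕ) ≤ j from not_lt.mp hc) j.2⟩, rfl⟩
      have := htri hlt
      rw [hf] at this
      rw [this, zero_mul]
    · intro m
      simp [hf, mul_comm]

theorem exists_isSVD {k : ℕ} (M : Matrix (Fin k) (Fin k) ℝ) :
    ∃ U σ V, IsSVD M U σ V := by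
  have hH : (Mᵀ * M).IsHermitian := by
    simpa using Matrix.isHermitian_conjTranspose_mul_self M
  have hT := Matrix.isSymmetric_toEuclideanLin_iff.mpr hH
  let b := hT.eigenvectorBasis (n := k) (by simp)
  let ev := hT.eigenvalues (n := k) (by simp)
  let V : Matrix (Fin k) (Fin k) ℝ := Matrix.of fun i j => b j i
  have hV : Vᵀ * V = 1 := transpose_mul_self_of_orthonormal b.orthonormal
  have hV' : V * Vᵀ = 1 := mul_eq_one_comm.mp hV
  have hHV : Mᵀ * M * V = V * diagonal ev := by
    ext i j
    have := congrArg (fun v => v i) (hT.apply_eigenvectorBasis (n := k) (by simp) j)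
    rw [Matrix.mul_diagonal, mul_comm]
    exact this
  -- The columns of `G = M V` are orthogonal, with squared lengths the eigenvalues.
  have hG : (M * V)ᵀ * (M * V) = diagonal ev := by
    rw [Matrix.transpose_mul, Matrix.mul_assoc, ← Matrix.mul_assoc Mᵀ, hHV, ← Matrix.mul_assoc,
      hV, Matrix.one_mul]
  have hGij : ∀ i j, ∑ l, (M * V) l i * (M * V) l j = if i = j then ev i else 0 := by
    intro i j
    have := congrFun (congrFun hG i) j
    rwa [Matrix.mul_apply, Matrix.diagonal_apply] at this
  have hev : ∀ i, 0 ≤ ev i := fun i => by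
    have := hGij i i
    rw [if_pos rfl] at this
    rw [← this]
    exact Finset.sum_nonneg fun l _ => mul_self_nonneg _
  let w : Fin k → EuclideanSpace ℝ (Fin k) := fun j =>
    WithLp.toLp 2 fun l => (Real.sqrt (ev j))⁻¹ * (M * V) l j
  have hw : Orthonormal ℝ (Set.domRestrict {j | ev j ≠ 0} w) := by
    rw [orthonormal_iff_ite]
    rintro ⟨i, hi⟩ ⟨j, hj⟩
    have : inner ℝ (w i) (w j) = (Real.sqrt (ev i))⁻¹ * (Real.sqrt (ev j))⁻¹ *
        ∑ l, (M * V) l i * (M * V) l j := by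
      simp only [w, PiLp.inner_apply, Finset.mul_sum]
      refine Finset.sum_congr rfl fun l _ => ?_
      simp
      ring
    change inner ℝ (w i) (w j) = _
    simp only [Subtype.mk.injEq]
    rw [this, hGij]
    split_ifs with hij
    · subst hij
      have h0 : Real.sqrt (ev i) ≠ 0 := (Real.sqrt_ne_zero (hev i)).mpr hi
      rw [← mul_inv, Real.mul_self_sqrt (hev i), inv_mul_cancel₀ hi]
    · simp
  obtain ⟨c, hc⟩ := hw.exists_orthonormalBasis_extension_of_card_eq (by simp)
  refine ⟨Matrix.of fun i j => c j i, fun j => Real.sqrt (ev j), V,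
    transpose_mul_self_of_orthonormal c.orthonormal, hV, ?_, fun i => Real.sqrt_nonneg _, ?_⟩
  · intro i j hij
    exact Real.sqrt_le_sqrt (hT.eigenvalues_antitone _ hij)
  · have : M * V = Matrix.of (fun i j => c j i) * diagonal (fun j => Real.sqrt (ev j)) := by
      ext i j
      rw [Matrix.mul_diagonal]
      by_cases h0 : ev j = 0
      · have hs := hGij j j
        rw [if_pos rfl, h0, Finset.sum_eq_zero_iff_of_nonneg
          (fun l _ => mul_self_nonneg _)] at hs
        have := mul_self_eq_zero.mp (hs i (Finset.mem_univ _))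
        simp [this, h0]
      · have h1 : Real.sqrt (ev j) ≠ 0 := (Real.sqrt_ne_zero (hev j)).mpr h0
        rw [Matrix.of_apply, hc j h0]
        simp only [w]
        field_simp
    rw [← this, Matrix.mul_assoc, hV', Matrix.mul_one]

/-! ### The spectral norm -/

theorem specNorm_eq_norm {m n : ℕ} (M : Matrix (Fin m) (Fin n) ℝ) : specNorm M = ‖M‖ := rfl

theorem norm_transpose_eq {m n : ℕ} (M : Matrix (Fin m) (Fin n) ℝ) : ‖Mᵀ‖ = ‖M‖ := by
  rw [← Matrix.conjTranspose_eq_transpose_of_trivial, Matrix.l2_opNorm_conjTranspose]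

theorem norm_transpose_mul_self {m n : ℕ} (M : Matrix (Fin m) (Fin n) ℝ) :
    ‖Mᵀ * M‖ = ‖M‖ * ‖M‖ := by
  rw [← Matrix.conjTranspose_eq_transpose_of_trivial, Matrix.l2_opNorm_conjTranspose_mul_self]

theorem norm_mul_le_one {m n p : ℕ} {A : Matrix (Fin m) (Fin n) ℝ} {B : Matrix (Fin n) (Fin p) ℝ}
    (hA : ‖A‖ ≤ 1) (hB : ‖B‖ ≤ 1) : ‖A * B‖ ≤ 1 :=
  (Matrix.l2_opNorm_mul A B).trans (mul_le_one₀ hA (norm_nonneg _) hB)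

theorem norm_le_one_of_partial_isometry {m n : ℕ} {Q : Matrix (Fin m) (Fin n) ℝ}
    (h : Q * (Qᵀ * Q) = Q) : ‖Q‖ ≤ 1 := by
  have h1 : (Qᵀ * Q)ᵀ * (Qᵀ * Q) = Qᵀ * Q := by
    rw [Matrix.transpose_mul, Matrix.transpose_transpose, Matrix.mul_assoc, h]
  have h2 := norm_transpose_mul_self (Qᵀ * Q)
  rw [h1, norm_transpose_mul_self] at h2
  by_contra! hc
  have h3 : 1 < ‖Q‖ * ‖Q‖ := by nlinarith
  nlinarith

theorem norm_le_one_of_isometry {m n : ℕ} {Q : Matrix (Fin m) (Fin n) ℝ}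
    (h : Qᵀ * Q = 1) : ‖Q‖ ≤ 1 :=
  norm_le_one_of_partial_isometry (by rw [h, Matrix.mul_one])

theorem dotProduct_mulVec_le {m n : ℕ} (N : Matrix (Fin m) (Fin n) ℝ)
    (x : EuclideanSpace ℝ (Fin m)) (y : EuclideanSpace ℝ (Fin n)) :
    x.ofLp ⬝ᵥ N *ᵥ y.ofLp ≤ ‖N‖ * (‖x‖ * ‖y‖) := by
  have h1 := N.l2_opNorm_mulVec y
  have h2 := real_inner_le_norm (WithLp.toLp 2 (N *ᵥ y.ofLp)) x
  have h3 : inner ℝ (WithLp.toLp 2 (N *ᵥ y.ofLp)) x = x.ofLp ⬝ᵥ N *ᵥ y.ofLp := by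
    simp [PiLp.inner_apply, dotProduct]
  rw [← h3]
  refine h2.trans ?_
  calc _ ≤ (‖N‖ * ‖y‖) * ‖x‖ := mul_le_mul_of_nonneg_right h1 (norm_nonneg _)
    _ = _ := by ring

theorem apply_le_norm {m n : ℕ} (N : Matrix (Fin m) (Fin n) ℝ) (i : Fin m) (j : Fin n) :
    N i j ≤ ‖N‖ := by
  have := dotProduct_mulVec_le N (EuclideanSpace.single i 1) (EuclideanSpace.single j 1)
  simpa using this

/-! ### Bounds for the nuclear norm -/

/-- The nuclear norm of `M` is at most `c`, expressed by duality with the spectral norm. -/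
def NuclearLE {m n : ℕ} (M : Matrix (Fin m) (Fin n) ℝ) (c : ℝ) : Prop :=
  ∀ W : Matrix (Fin m) (Fin n) ℝ, ‖W‖ ≤ 1 → (Wᵀ * M).trace ≤ c

theorem NuclearLE.nonneg {m n : ℕ} {M : Matrix (Fin m) (Fin n) ℝ} {c : ℝ} (h : NuclearLE M c) :
    0 ≤ c := by
  simpa using h 0 (by simp)

theorem NuclearLE.mono {m n : ℕ} {M : Matrix (Fin m) (Fin n) ℝ} {c c' : ℝ} (h : NuclearLE M c)
    (hc : c ≤ c') : NuclearLE M c' := fun W hW => (h W hW).trans hc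

theorem NuclearLE.add_vecMulVec {m n : ℕ} {M : Matrix (Fin m) (Fin n) ℝ} {c : ℝ}
    (h : NuclearLE M c) {x : EuclideanSpace ℝ (Fin m)} {y : EuclideanSpace ℝ (Fin n)}
    (hx : ‖x‖ = 1) (hy : ‖y‖ = 1) :
    NuclearLE (M + vecMulVec x.ofLp y.ofLp) (c + 1) := by
  intro W hW
  rw [Matrix.mul_add, Matrix.trace_add, Matrix.mul_vecMulVec, Matrix.trace_vecMulVec]
  refine add_le_add (h W hW) ?_
  have := dotProduct_mulVec_le Wᵀ y x
  rw [norm_transpose_eq, hx, hy, mul_one, mul_one] at this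
  rw [dotProduct_comm]
  exact this.trans hW

/-! ### Singular decompositions -/

/-- `M = P diag(σ) P'ᵀ`, where the columns of `P` and `P'` that belong to non-zero entries of the
nonnegative vector `σ` are orthonormal, and `P`, `P'` are contractions. Columns that belong to
zero entries of `σ` may be degenerate. -/
structure IsSingularDecomp {m n k : ℕ} (M : Matrix (Fin m) (Fin n) ℝ)
    (P : Matrix (Fin m) (Fin k) ℝ) (σ : Fin k → ℝ) (P' : Matrix (Fin n) (Fin k) ℝ) : Prop where
  eq : M = P * diagonal σ * P'ᵀ
  norm_left : ‖P‖ ≤ 1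
  norm_right : ‖P'‖ ≤ 1
  left : Pᵀ * P * diagonal σ = diagonal σ
  right : diagonal σ * (P'ᵀ * P') = diagonal σ
  nonneg : ∀ i, 0 ≤ σ i

section
variable {m n k : ℕ} {M : Matrix (Fin m) (Fin n) ℝ}
    {P : Matrix (Fin m) (Fin k) ℝ} {σ : Fin k → ℝ} {P' : Matrix (Fin n) (Fin k) ℝ}

/-- The nuclear norm of `M` is at least the sum of the singular values: test with `W = P P'ᵀ`. -/
theorem IsSingularDecomp.sum_le (h : IsSingularDecomp M P σ P') {c : ℝ} (hc : NuclearLE M c) :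
    ∑ i, σ i ≤ c := by
  have h1 := hc (P * P'ᵀ)
    (norm_mul_le_one h.norm_left (by rw [norm_transpose_eq]; exact h.norm_right))
  have h2 : (P * P'ᵀ)ᵀ * M = P' * (diagonal σ * P'ᵀ) := by
    rw [h.eq, Matrix.transpose_mul, Matrix.transpose_transpose]
    simp only [Matrix.mul_assoc]
    rw [← Matrix.mul_assoc P, ← Matrix.mul_assoc Pᵀ, ← Matrix.mul_assoc Pᵀ, h.left]
  rw [h2, Matrix.trace_mul_comm, Matrix.mul_assoc, h.right, Matrix.trace_diagonal] at h1
  exact h1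

theorem IsSingularDecomp.nuclearLE (h : IsSingularDecomp M P σ P') {τ : Fin k → ℝ}
    (hτ : ∀ i, 0 ≤ τ i) : NuclearLE (P * diagonal τ * P'ᵀ) (∑ i, τ i) := by
  intro W hW
  have h1 : (Wᵀ * (P * diagonal τ * P'ᵀ)).trace = ((P'ᵀ * Wᵀ * P) * diagonal τ).trace := by
    rw [← Matrix.mul_assoc, Matrix.trace_mul_comm]
    simp only [Matrix.mul_assoc]
  have h2 : ‖P'ᵀ * Wᵀ * P‖ ≤ 1 :=
    norm_mul_le_one (norm_mul_le_one (by rw [norm_transpose_eq]; exact h.norm_right)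
      (by rw [norm_transpose_eq]; exact hW)) h.norm_left
  rw [h1, Matrix.trace]
  refine Finset.sum_le_sum fun i _ => ?_
  rw [Matrix.diag_apply, Matrix.mul_diagonal]
  exact mul_le_of_le_one_left (hτ i) ((apply_le_norm _ i i).trans h2)

theorem IsSingularDecomp.norm_le (h : IsSingularDecomp M P σ P') {τ : Fin k → ℝ} {b : ℝ}
    (hb : 0 ≤ b) (hτ : ∀ i, 0 ≤ τ i) (hτb : ∀ i, τ i ≤ b) : ‖P * diagonal τ * P'ᵀ‖ ≤ b := by
  have hd : ‖diagonal τ‖ ≤ b := by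
    rw [Matrix.l2_opNorm_diagonal, pi_norm_le_iff_of_nonneg hb]
    intro i
    rw [Real.norm_of_nonneg (hτ i)]
    exact hτb i
  calc ‖P * diagonal τ * P'ᵀ‖ ≤ ‖P * diagonal τ‖ * ‖P'ᵀ‖ := Matrix.l2_opNorm_mul _ _
    _ ≤ ‖P * diagonal τ‖ * 1 := by
        gcongr
        rw [norm_transpose_eq]; exact h.norm_right
    _ ≤ ‖P‖ * ‖diagonal τ‖ * 1 := by
        gcongr
        exact Matrix.l2_opNorm_mul _ _
    _ ≤ 1 * b * 1 := by
        gcongr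
        exact h.norm_left
    _ = b := by ring

theorem rank_mul_diagonal_mul_le (P : Matrix (Fin m) (Fin k) ℝ) (τ : Fin k → ℝ)
    (P' : Matrix (Fin n) (Fin k) ℝ) :
    (P * diagonal τ * P'ᵀ).rank ≤ (Finset.univ.filter fun i => τ i ≠ 0).card := by
  classical
  have h := Matrix.rank_diagonal τ
  rw [Fintype.card_subtype] at h
  rw [← h]
  exact (Matrix.rank_mul_le_left _ _).trans (Matrix.rank_mul_le_right _ _)

theorem IsSingularDecomp.card_le_rank (h : IsSingularDecomp M P σ P') :
    (Finset.univ.filter fun i => σ i ≠ 0).card ≤ M.rank := by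
  classical
  have hd := Matrix.rank_diagonal σ
  rw [Fintype.card_subtype] at hd
  have : diagonal σ = Pᵀ * M * P' := by
    rw [h.eq]
    simp only [← Matrix.mul_assoc]
    rw [h.left, Matrix.mul_assoc, h.right]
  rw [← hd, this]
  exact (Matrix.rank_mul_le_left _ _).trans (Matrix.rank_mul_le_right _ _)

end

/-- Appending a pair of columns to a sketch raises the rank of its product by at most one. -/
theorem rank_add_vecMulVec_le {m n : ℕ} (M : Matrix (Fin m) (Fin n) ℝ) (x : Fin m → ℝ)
    (y : Fin n → ℝ) : (M + vecMulVec x y).rank ≤ M.rank + 1 := by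
  have h1 : (M + vecMulVec x y).rank ≤ M.rank + (vecMulVec x y).rank := by
    simp only [Matrix.rank]
    refine le_trans (Submodule.finrank_mono ?_)
      (Submodule.finrank_add_le_finrank_add_finrank _ _)
    rintro _ ⟨v, rfl⟩
    rw [Matrix.mulVecLin_add]
    exact Submodule.add_mem_sup (LinearMap.mem_range_self _ v) (LinearMap.mem_range_self _ v)
  have := Matrix.rank_vecMulVec_le x y
  omega

/-! ### Factorizations of the sketch matrices -/

/-- `A = Q R`, where `Q` is a partial isometry whose initial space contains the columns of `R`.
This holds for a QR decomposition, and survives both the incremental update, which may append a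
zero column to `Q`, and the removal of singular directions, which destroys the triangular shape
of `R`. -/
structure IsFactorization {d k : ℕ} (A Q : Matrix (Fin d) (Fin k) ℝ)
    (R : Matrix (Fin k) (Fin k) ℝ) : Prop where
  eq : A = Q * R
  range : Qᵀ * Q * R = R
  isometry : Q * (Qᵀ * Q) = Q

theorem IsQR.isFactorization {d k : ℕ} {A Q : Matrix (Fin d) (Fin k) ℝ}
    {R : Matrix (Fin k) (Fin k) ℝ} (h : IsQR A Q R) : IsFactorization A Q R where
  eq := h.2.2
  range := by rw [h.1, Matrix.one_mul]
  isometry := by rw [h.1, Matrix.mul_one]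

/-- An SVD of the small matrix `R R'ᵀ` gives the singular directions of `A Bᵀ`. -/
theorem IsFactorization.isSingularDecomp {dx dy k : ℕ} {A Q : Matrix (Fin dx) (Fin k) ℝ}
    {R : Matrix (Fin k) (Fin k) ℝ} {B Q' : Matrix (Fin dy) (Fin k) ℝ}
    {R' : Matrix (Fin k) (Fin k) ℝ} (hA : IsFactorization A Q R) (hB : IsFactorization B Q' R')
    {U V : Matrix (Fin k) (Fin k) ℝ} {σ : Fin k → ℝ} (h : IsSVD (R * R'ᵀ) U σ V) :
    IsSingularDecomp (A * Bᵀ) (Q * U) σ (Q' * V) := by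
  obtain ⟨hU, hV, -, hσ, hM⟩ := h
  -- `Qᵀ Q` fixes the columns of `U` that belong to non-zero singular values, as these lie in the
  -- range of `R`.
  have h1 : U * diagonal σ = R * R'ᵀ * V := by
    rw [hM, Matrix.mul_assoc, hV, Matrix.mul_one]
  have h2 : diagonal σ * Vᵀ = Uᵀ * (R * R'ᵀ) := by
    rw [hM, Matrix.mul_assoc, ← Matrix.mul_assoc, hU, Matrix.one_mul]
  have h3 : R'ᵀ * (Q'ᵀ * Q') = R'ᵀ := by
    have := congrArg Matrix.transpose hB.range
    simpa only [Matrix.transpose_mul, Matrix.transpose_transpose] using this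
  refine ⟨?_, norm_mul_le_one (norm_le_one_of_partial_isometry hA.isometry)
      (norm_le_one_of_isometry hU), norm_mul_le_one (norm_le_one_of_partial_isometry hB.isometry)
      (norm_le_one_of_isometry hV), ?_, ?_, hσ⟩
  · rw [hA.eq, hB.eq, Matrix.transpose_mul, Matrix.transpose_mul, Matrix.mul_assoc,
      ← Matrix.mul_assoc R, hM]
    simp only [Matrix.mul_assoc]
  · calc (Q * U)ᵀ * (Q * U) * diagonal σ = Uᵀ * (Qᵀ * Q * (U * diagonal σ)) := by
          simp only [Matrix.transpose_mul, Matrix.mul_assoc]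
      _ = Uᵀ * (U * diagonal σ) := by
          rw [h1, Matrix.mul_assoc R, ← Matrix.mul_assoc _ R, hA.range]
      _ = diagonal σ := by rw [← Matrix.mul_assoc, hU, Matrix.one_mul]
  · calc diagonal σ * ((Q' * V)ᵀ * (Q' * V)) = diagonal σ * Vᵀ * (Q'ᵀ * Q') * V := by
          simp only [Matrix.transpose_mul, Matrix.mul_assoc]
      _ = diagonal σ * Vᵀ * V := by
          rw [h2, Matrix.mul_assoc Uᵀ, Matrix.mul_assoc R, h3]
      _ = diagonal σ := by rw [Matrix.mul_assoc, hV, Matrix.mul_one]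

/-! ### Total correctness of computations -/

/-- Total correctness: the computation has an outcome, and every outcome `a` with its step count
`n` satisfies `P a n`. -/
def Comp.Spec {α : Type} (c : Comp α) (P : α → ℕ → Prop) : Prop :=
  (∃ a n, c.Returns a n) ∧ ∀ a n, c.Returns a n → P a n

theorem Comp.Spec.mono {α : Type} {c : Comp α} {P Q : α → ℕ → Prop} (h : c.Spec P)
    (hPQ : ∀ a n, P a n → Q a n) : c.Spec Q :=
  ⟨h.1, fun a n hr => hPQ a n (h.2 a n hr)⟩

theorem Comp.Spec.bind {α β : Type} {c : Comp α} {f : α → Comp β} {P : α → ℕ → Prop}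
    {Q : β → ℕ → Prop} (hc : c.Spec P)
    (hf : ∀ a n, P a n → (f a).Spec fun b m => Q b (n + m)) : (c >>= f).Spec Q := by
  constructor
  · obtain ⟨a, n, ha⟩ := hc.1
    obtain ⟨b, m, hb⟩ := (hf a n (hc.2 a n ha)).1
    exact ⟨b, n + m, a, n, m, ha, hb, rfl⟩
  · rintro b _ ⟨a, n, m, ha, hb, rfl⟩
    exact (hf a n (hc.2 a n ha)).2 b m hb

theorem Comp.Spec.pure {α : Type} {a : α} {P : α → ℕ → Prop} (h : P a 0) :
    (Pure.pure a : Comp α).Spec P :=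
  ⟨⟨a, 0, rfl, rfl⟩, by rintro _ _ ⟨rfl, rfl⟩; exact h⟩

theorem Comp.Spec.charge_bind {β : Type} {n : ℕ} {f : Unit → Comp β} {Q : β → ℕ → Prop}
    (h : (f ()).Spec fun b m => Q b (n + m)) : (charge n >>= f).Spec Q :=
  Comp.Spec.bind (P := fun _ m => m = n) ⟨⟨(), n, rfl⟩, fun _ _ h => h⟩ (by rintro _ _ rfl; exact h)

theorem Comp.Spec.mulMat_bind {β : Type} {m k p : ℕ} {A : Matrix (Fin m) (Fin k) ℝ}
    {B : Matrix (Fin k) (Fin p) ℝ} {f : Matrix (Fin m) (Fin p) ℝ → Comp β} {Q : β → ℕ → Prop}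
    (h : (f (A * B)).Spec fun b n => Q b (2 * m * k * p + n)) : (mulMat A B >>= f).Spec Q :=
  Comp.Spec.bind (P := fun M n => M = A * B ∧ n = 2 * m * k * p)
    (Comp.Spec.charge_bind (Comp.Spec.pure ⟨rfl, rfl⟩)) (by rintro _ _ ⟨rfl, rfl⟩; exact h)

theorem Comp.Spec.mulVector_bind {β : Type} {m k : ℕ} {A : Matrix (Fin m) (Fin k) ℝ}
    {v : Fin k → ℝ} {f : (Fin m → ℝ) → Comp β} {Q : β → ℕ → Prop}
    (h : (f (A *ᵥ v)).Spec fun b n => Q b (2 * m * k + n)) : (mulVector A v >>= f).Spec Q :=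
  Comp.Spec.bind (P := fun w n => w = A *ᵥ v ∧ n = 2 * m * k)
    (Comp.Spec.charge_bind (Comp.Spec.pure ⟨rfl, rfl⟩)) (by rintro _ _ ⟨rfl, rfl⟩; exact h)

theorem qr_spec (κ : ℕ) {d k : ℕ} (h : k ≤ d) (A : Matrix (Fin d) (Fin k) ℝ) :
    (qr κ A).Spec fun r n => IsQR A r.1 r.2 ∧ n ≤ κ * (d * k ^ 2) := by
  obtain ⟨Q, R, hQR⟩ := exists_isQR h A
  exact ⟨⟨(Q, R), 0, hQR, Nat.zero_le _⟩, fun _ _ h => h⟩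

theorem svd_spec (κ : ℕ) {k : ℕ} (M : Matrix (Fin k) (Fin k) ℝ) :
    (svd κ M).Spec fun r n => IsSVD M r.1 r.2.1 r.2.2 ∧ n ≤ κ * k ^ 3 := by
  obtain ⟨U, σ, V, h⟩ := exists_isSVD M
  exact ⟨⟨(U, σ, V), 0, h, Nat.zero_le _⟩, fun _ _ h => h⟩

/-! ### Appending a column -/

theorem appendCol_mul_borderR {d k : ℕ} (Q : Matrix (Fin d) (Fin k) ℝ) (q : Fin d → ℝ)
    (R : Matrix (Fin k) (Fin k) ℝ) (v : Fin k → ℝ) (r : ℝ) :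
    appendCol Q q * borderR R v r = appendCol (Q * R) (Q *ᵥ v + r • q) := by
  ext i j
  refine Fin.lastCases ?_ (fun j => ?_) j <;>
  simp [appendCol, borderR, Matrix.mul_apply, Fin.sum_univ_castSucc, Matrix.mulVec, dotProduct,
    mul_comm]

theorem borderR_mul_borderR {k : ℕ} (G R : Matrix (Fin k) (Fin k) ℝ) (v : Fin k → ℝ) (g r : ℝ) :
    borderR G 0 g * borderR R v r = borderR (G * R) (G *ᵥ v) (g * r) := by
  ext i j
  refine Fin.lastCases ?_ (fun i => ?_) i <;> refine Fin.lastCases ?_ (fun j => ?_) j <;>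
  simp [borderR, Matrix.mul_apply, Fin.sum_univ_castSucc, Matrix.mulVec, dotProduct]

theorem appendCol_gram {d k : ℕ} (Q : Matrix (Fin d) (Fin k) ℝ) (q : Fin d → ℝ)
    (h : Qᵀ *ᵥ q = 0) :
    (appendCol Q q)ᵀ * appendCol Q q = borderR (Qᵀ * Q) 0 (q ⬝ᵥ q) := by
  have h' : ∀ j, ∑ x, Q x j * q x = 0 := fun j => congrFun h j
  ext i j
  refine Fin.lastCases ?_ (fun i => ?_) i <;> refine Fin.lastCases ?_ (fun j => ?_) j <;>
  simp [appendCol, borderR, Matrix.mul_apply, dotProduct, h']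
  rw [← h' j]
  exact Finset.sum_congr rfl fun x _ => mul_comm _ _

theorem appendCol_mul_appendCol_transpose {dx dy k : ℕ} (A : Matrix (Fin dx) (Fin k) ℝ)
    (B : Matrix (Fin dy) (Fin k) ℝ) (x : Fin dx → ℝ) (y : Fin dy → ℝ) :
    appendCol A x * (appendCol B y)ᵀ = A * Bᵀ + vecMulVec x y := by
  ext i j
  simp [appendCol, Matrix.mul_apply, Fin.sum_univ_castSucc, vecMulVec_apply]

/-- Appending a column `x` whose component orthogonal to the columns of `Q` is `r • q`. The vector
`q` is a unit vector or, if this component vanishes, zero. -/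
theorem IsFactorization.appendCol {d k : ℕ} {A Q : Matrix (Fin d) (Fin k) ℝ}
    {R : Matrix (Fin k) (Fin k) ℝ} (h : IsFactorization A Q R) {x q : Fin d → ℝ} {r : ℝ}
    (hx : Q *ᵥ (Qᵀ *ᵥ x) + r • q = x) (hq : Qᵀ *ᵥ q = 0) (hr : q ⬝ᵥ q * r = r)
    (hqq : (q ⬝ᵥ q) • q = q) :
    IsFactorization (appendCol A x) (SOCOD.appendCol Q q) (borderR R (Qᵀ *ᵥ x) r) where
  eq := by rw [appendCol_mul_borderR, hx, ← h.eq]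
  range := by
    have h1 : Qᵀ * Q * Qᵀ = Qᵀ := by
      have := congrArg Matrix.transpose h.isometry
      simpa only [Matrix.transpose_mul, Matrix.transpose_transpose] using this
    rw [appendCol_gram Q q hq, borderR_mul_borderR, h.range, hr, Matrix.mulVec_mulVec, h1]
  isometry := by
    rw [appendCol_gram Q q hq, appendCol_mul_borderR, h.isometry, hqq, Matrix.mulVec_zero,
      zero_add]

theorem incDec_spec {d k : ℕ} {A Q : Matrix (Fin d) (Fin k) ℝ} {R : Matrix (Fin k) (Fin k) ℝ}
    (h : IsFactorization A Q R) (x : Fin d → ℝ) :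
    (incDec Q R x).Spec fun r n => IsFactorization (appendCol A x) r.1 r.2 ∧
      n = 4 * d * k + 4 * d + 2 * k + 2 := by
  refine .mulVector_bind <| .mulVector_bind <| .charge_bind <| .charge_bind <| .charge_bind <|
    .pure ⟨?_, by ring⟩
  set x' : Fin d → ℝ := x - Q *ᵥ (Qᵀ *ᵥ x) with hx'
  have hs : 0 ≤ ∑ i, x' i ^ 2 := Finset.sum_nonneg fun i _ => sq_nonneg _
  have hdot : x' ⬝ᵥ x' = ∑ i, x' i ^ 2 := by
    simp only [dotProduct, sq]
  have horth : Qᵀ *ᵥ x' = 0 := by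
    have h1 : Qᵀ * Q * Qᵀ = Qᵀ := by
      have := congrArg Matrix.transpose h.isometry
      simpa only [Matrix.transpose_mul, Matrix.transpose_transpose] using this
    rw [hx', Matrix.mulVec_sub, Matrix.mulVec_mulVec, Matrix.mulVec_mulVec, h1, sub_self]
  by_cases hr : √(∑ i, x' i ^ 2) = 0
  · have hx0 : x' = 0 := by
      rw [Real.sqrt_eq_zero hs, ← hdot] at hr
      exact dotProduct_self_eq_zero.mp hr
    refine h.appendCol ?_ ?_ ?_ ?_
    · rw [hr, zero_smul, add_zero]
      exact (sub_eq_zero.mp hx0).symm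
    · simp [hx0]
    · rw [hr, mul_zero]
    · simp [hx0]
  · have hqq : ((√(∑ i, x' i ^ 2))⁻¹ • x') ⬝ᵥ ((√(∑ i, x' i ^ 2))⁻¹ • x') = 1 := by
      rw [smul_dotProduct, dotProduct_smul, hdot, smul_eq_mul, smul_eq_mul]
      nth_rewrite 3 [← Real.mul_self_sqrt hs]
      field_simp
    refine h.appendCol ?_ ?_ ?_ ?_
    · rw [smul_smul, mul_inv_cancel₀ hr, one_smul, hx']
      abel
    · rw [Matrix.mulVec_smul, horth, smul_zero]
    · rw [hqq, one_mul]
    · rw [hqq, one_smul]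

/-! ### Compression -/

theorem lt_survivors {k : ℕ} {σ : Fin k → ℝ} (hσ : Antitone σ) {δ : ℝ} {i : Fin k}
    (hi : δ < σ i) : (i : ℕ) < survivors σ δ := by
  have h : Finset.Iic i ⊆ Finset.univ.filter fun j => δ < σ j := fun j hj => by
    simpa using hi.trans_le (hσ (Finset.mem_Iic.mp hj))
  have := Finset.card_le_card h
  rw [Fin.card_Iic] at this
  exact this

theorem survivors_le_of_antitone {k : ℕ} {σ : Fin k → ℝ} (hσ : Antitone σ) (i : Fin k) :
    survivors σ (σ i) ≤ i := by
  have h : (Finset.univ.filter fun j => σ i < σ j) ⊆ Finset.Iio i := fun j hj => by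
    rw [Finset.mem_Iio]
    by_contra hc
    exact absurd (hσ (not_lt.mp hc)) (not_le.mpr (Finset.mem_filter.mp hj).2)
  have := Finset.card_le_card h
  rwa [Fin.card_Iio] at this

theorem takeCols_mul_transpose {dx dy k c : ℕ} (h : c ≤ k) (P : Matrix (Fin dx) (Fin k) ℝ)
    (P' : Matrix (Fin dy) (Fin k) ℝ) (ρ : Fin k → ℝ) (hρ : ∀ i : Fin k, c ≤ i → ρ i = 0) :
    takeCols h (P * diagonal ρ) * (takeCols h (P' * diagonal ρ))ᵀ =
      P * diagonal (fun i => ρ i * ρ i) * P'ᵀ := by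
  ext i j
  rw [Matrix.mul_apply, Matrix.mul_apply]
  refine Fintype.sum_of_injective (Fin.castLE h) (Fin.castLE_injective h) _ _ ?_ ?_
  · intro m hm
    have : c ≤ m := by
      by_contra hc
      exact hm ⟨⟨m, not_le.mp hc⟩, rfl⟩
    rw [Matrix.mul_diagonal, hρ m this]
    ring
  · intro m
    simp only [takeCols, Matrix.mul_diagonal, Matrix.transpose_apply, Matrix.submatrix_apply, id]
    ring

/-- `M'` arises from `M` by a compression with shrinkage `δ` in a sketch of size `l`: the error is
at most `δ`, the nuclear norm decreases by at least `δ l / 2`, and the rank does not grow. -/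
structure Shrinks (l : ℕ) {m n : ℕ} (M M' : Matrix (Fin m) (Fin n) ℝ) (δ : ℝ) : Prop where
  nonneg : 0 ≤ δ
  error : ‖M - M'‖ ≤ δ
  nuclear : ∀ c, NuclearLE M c → NuclearLE M' (c - l / 2 * δ)
  rank : M'.rank ≤ M.rank

theorem Shrinks.refl (l : ℕ) {m n : ℕ} (M : Matrix (Fin m) (Fin n) ℝ) : Shrinks l M M 0 where
  nonneg := le_rfl
  error := by simp
  nuclear := by simp
  rank := le_rfl

theorem IsSingularDecomp.shrinks {m n k l : ℕ} {M : Matrix (Fin m) (Fin n) ℝ}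
    {P : Matrix (Fin m) (Fin k) ℝ} {σ : Fin k → ℝ} {P' : Matrix (Fin n) (Fin k) ℝ}
    (h : IsSingularDecomp M P σ P') (hσ : Antitone σ) (hl : (l - 1) / 2 < k) :
    Shrinks l M (P * diagonal (fun i => max (σ i - σ ⟨(l - 1) / 2, hl⟩) 0) * P'ᵀ)
      (σ ⟨(l - 1) / 2, hl⟩) := by
  set δ := σ ⟨(l - 1) / 2, hl⟩ with hδ
  have hδ0 : 0 ≤ δ := h.nonneg _
  refine ⟨hδ0, ?_, fun c hc => ?_, ?_⟩
  · have : M - P * diagonal (fun i => max (σ i - δ) 0) * P'ᵀ =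
        P * diagonal (fun i => σ i - max (σ i - δ) 0) * P'ᵀ := by
      rw [h.eq, ← Matrix.sub_mul, ← Matrix.mul_sub, Matrix.diagonal_sub]
    rw [this]
    refine h.norm_le hδ0 (fun i => ?_) fun i => ?_
    · exact sub_nonneg.mpr (max_le (sub_le_self _ hδ0) (h.nonneg i))
    · have := le_max_left (σ i - δ) 0
      linarith
  · refine (h.nuclearLE fun i => le_max_right _ _).mono ?_
    -- The first `(l - 1) / 2 + 1 ≥ l / 2` singular values lose `δ` each.
    have h1 : (l : ℝ) / 2 * δ ≤ ∑ i, (σ i - max (σ i - δ) 0) := by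
      have hcard : ((Finset.Iic (⟨(l - 1) / 2, hl⟩ : Fin k)).card : ℝ) * δ ≤
          ∑ i, (σ i - max (σ i - δ) 0) := by
        rw [← nsmul_eq_mul, ← Finset.sum_const]
        refine (Finset.sum_le_sum fun i hi => ?_).trans
          (Finset.sum_le_sum_of_subset_of_nonneg (Finset.subset_univ _) fun i _ _ => ?_)
        · have : δ ≤ σ i := hσ (Finset.mem_Iic.mp hi)
          rw [max_eq_left (by linarith)]
          linarith
        · exact sub_nonneg.mpr (max_le (sub_le_self _ hδ0) (h.nonneg i))
      refine le_trans (mul_le_mul_of_nonneg_right ?_ hδ0) hcard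
      rw [Fin.card_Iic, div_le_iff₀ (by norm_num)]
      have : l ≤ ((l - 1) / 2 + 1) * 2 := by omega
      exact_mod_cast this
    rw [Finset.sum_sub_distrib] at h1
    have h2 := h.sum_le hc
    linarith
  · refine (rank_mul_diagonal_mul_le _ _ _).trans (le_trans (Finset.card_le_card ?_) h.card_le_rank)
    intro i hi
    simp only [Finset.mem_filter, Finset.mem_univ, true_and] at hi ⊢
    intro h0
    rw [h0, max_eq_right (by linarith)] at hi
    exact hi rfl

/-- The bound on the number of steps is quadratic in the number of columns, hence too large for
every update; it is amortized in `insert_spec`. -/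
theorem compress_spec (κ l : ℕ) {dx dy k : ℕ} (A : Matrix (Fin dx) (Fin (k + 1)) ℝ)
    (B : Matrix (Fin dy) (Fin (k + 1)) ℝ) (h : l ≤ k + 1) (hx : k + 1 ≤ dx) (hy : k + 1 ≤ dy) :
    (compress κ l A B h).Spec fun r n => r.1 ≤ (l - 1) / 2 ∧
      (∃ δ, Shrinks l (A * Bᵀ) (r.2.1 * r.2.2ᵀ) δ) ∧
      n ≤ (2 * κ + 9) * ((dx + dy) * (k + 1) ^ 2) := by
  refine .bind (qr_spec κ hx A) fun X n₁ hX => .bind (qr_spec κ hy B) fun Y n₂ hY =>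
    .mulMat_bind <| .bind (svd_spec κ _) fun D n₃ hD => .charge_bind <| .mulMat_bind <|
    .mulMat_bind <| .charge_bind <| .pure ?_
  have hdec := hX.1.isFactorization.isSingularDecomp hY.1.isFactorization hD.1
  have hanti := hD.1.2.2.1
  refine ⟨survivors_le_of_antitone hanti _, ⟨D.2.1 ⟨(l - 1) / 2, by omega⟩, ?_⟩, ?_⟩
  · have := hdec.shrinks (l := l) hanti (by omega)
    convert this using 1
    dsimp only
    rw [takeCols_mul_transpose]
    · simp only [Real.mul_self_sqrt (le_max_right _ _)]
    · intro i hi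
      rw [Real.sqrt_eq_zero (le_max_right _ _), max_eq_right_iff, sub_nonpos]
      by_contra hc
      exact absurd (lt_survivors hanti (not_le.mp hc)) (not_lt.mpr hi)
  · have h1 := hX.2
    have h2 := hY.2
    have h3 := hD.2
    obtain ⟨a, rfl⟩ := Nat.exists_eq_add_of_le hx
    have h4 : (k + 1) ^ 3 ≤ (k + 1 + a + dy) * (k + 1) ^ 2 := by
      rw [pow_succ' (k + 1) 2]
      exact Nat.mul_le_mul_right _ (by omega)
    have h5 := Nat.mul_le_mul_left κ h4
    have h6 : k + 1 ≤ (k + 1 + a + dy) * (k + 1) ^ 2 :=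
      (by nlinarith : k + 1 ≤ (k + 1) ^ 3).trans h4
    have h7 : (k + 1 + a + dy) * (k + 1) ≤ (k + 1 + a + dy) * (k + 1) ^ 2 :=
      Nat.mul_le_mul_left _ (by nlinarith)
    nlinarith

/-! ### Insertion -/

/-- The stored decompositions are factorizations of the sketch matrices. -/
def Factors.Valid {dx dy k : ℕ} (F : Factors dx dy k) : Prop :=
  IsFactorization F.A F.QX F.RX ∧ IsFactorization F.B F.QY F.RY

/-- The cost of one insertion, amortized by a potential that is proportional to the number of
occupied columns: a compression halves that number and thereby releases the potential that pays
for it. -/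
theorem insert_spec (κ l : ℕ) {dx dy k : ℕ} (x : Fin dx → ℝ) (y : Fin dy → ℝ)
    {F : Factors dx dy k} (hF : F.Valid) (hk : k < l) (hx : l ≤ dx) (hy : l ≤ dy) :
    (insert κ l x y F).Spec fun r n => r.1 < l ∧ r.2.Valid ∧
      (∃ δ, Shrinks l (F.A * F.Bᵀ + vecMulVec x y) (r.2.A * r.2.Bᵀ) δ) ∧
      n + (6 * κ + 22) * ((dx + dy) * l) * r.1 ≤
        (6 * κ + 22) * ((dx + dy) * l) * k + (6 * κ + 42) * ((dx + dy) * l) := by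
  refine .charge_bind ?_
  by_cases h : l ≤ k + 1
  · obtain rfl : l = k + 1 := by omega
    simp only [h, ↓reduceDIte]
    refine .bind (compress_spec κ (k + 1) _ _ h hx hy) ?_
    rintro ⟨c, A', B'⟩ n₁ ⟨hc, hsh, hn₁⟩
    dsimp only at hc hsh hn₁ ⊢
    refine .bind (qr_spec κ (by omega) A') fun X n₂ hX => .bind (qr_spec κ (by omega) B')
      fun Y n₃ hY => .pure ⟨by dsimp only; omega, ⟨hX.1.isFactorization, hY.1.isFactorization⟩,
        ?_, ?_⟩
    · rw [appendCol_mul_appendCol_transpose] at hsh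
      exact hsh
    · have h2 := hX.2
      have h3 := hY.2
      dsimp only
      have hck : c ^ 2 ≤ (k + 1) ^ 2 := Nat.pow_le_pow_left (by omega) 2
      have h4 : κ * (dx * c ^ 2) ≤ κ * (dx * (k + 1) ^ 2) := by gcongr
      have h5 : κ * (dy * c ^ 2) ≤ κ * (dy * (k + 1) ^ 2) := by gcongr
      have h6 : (6 * κ + 22) * ((dx + dy) * (k + 1)) * c ≤
          (3 * κ + 11) * ((dx + dy) * (k + 1)) * k := by
        have : 2 * c ≤ k := by omega
        calc (6 * κ + 22) * ((dx + dy) * (k + 1)) * c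
            = (3 * κ + 11) * ((dx + dy) * (k + 1)) * (2 * c) := by ring
          _ ≤ _ := by gcongr
      have h7 : dx + dy ≤ (dx + dy) * (k + 1) ^ 2 := Nat.le_mul_of_pos_right _ (by positivity)
      have h8 : 1 ≤ dx + dy := by omega
      have h9 : n₁ + n₂ + n₃ + (dx + dy + 1) ≤ (3 * κ + 11) * ((dx + dy) * (k + 1) ^ 2) := by
        nlinarith
      have h10 : (3 * κ + 11) * ((dx + dy) * (k + 1) ^ 2) =
          (3 * κ + 11) * ((dx + dy) * (k + 1)) * k + (3 * κ + 11) * ((dx + dy) * (k + 1)) := by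
        ring
      have h11 : (3 * κ + 11) * ((dx + dy) * (k + 1)) ≤
          (6 * κ + 42) * ((dx + dy) * (k + 1)) := by gcongr <;> omega
      have h12 : (6 * κ + 22) * ((dx + dy) * (k + 1)) * k =
        (3 * κ + 11) * ((dx + dy) * (k + 1)) * k + (3 * κ + 11) * ((dx + dy) * (k + 1)) * k := by
        ring
      omega
  · simp only [h, ↓reduceDIte]
    refine .bind (incDec_spec hF.1 x) fun X n₁ hX => .bind (incDec_spec hF.2 y)
      fun Y n₂ hY => .pure ⟨by dsimp only; omega, ⟨hX.1, hY.1⟩, ⟨0, ?_⟩, ?_⟩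
    · dsimp only
      rw [appendCol_mul_appendCol_transpose]
      exact Shrinks.refl _ _
    · dsimp only
      rw [hX.2, hY.2]
      have h1 : (dx + dy) * k ≤ (dx + dy) * l := Nat.mul_le_mul_left _ hk.le
      have h2 : (dx + dy) ≤ (dx + dy) * l := Nat.le_mul_of_pos_right _ (by omega)
      have h3 : l ≤ (dx + dy) * l := Nat.le_mul_of_pos_left _ (by omega)
      nlinarith

/-! ### Registration of snapshots -/

theorem IsSVD.transpose {k : ℕ} {M U V : Matrix (Fin k) (Fin k) ℝ} {σ : Fin k → ℝ}
    (h : IsSVD M U σ V) : IsSVD Mᵀ V σ U :=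
  ⟨h.2.1, h.1, h.2.2.1, h.2.2.2.1, by
    rw [h.2.2.2.2, Matrix.transpose_mul, Matrix.transpose_mul, Matrix.transpose_transpose,
      Matrix.diagonal_transpose, Matrix.mul_assoc]⟩

/-- Removing the left singular vectors for a set of non-zero singular values from `R` keeps a
factorization: these vectors lie in the range of `R`, and so in the initial space of `Q`. The
vector `g` is `0` on the removed directions and `1` on the others. -/
theorem IsFactorization.deflate {d k : ℕ} {A Q : Matrix (Fin d) (Fin k) ℝ}
    {R R' U V : Matrix (Fin k) (Fin k) ℝ} {σ : Fin k → ℝ} (hA : IsFactorization A Q R)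
    (h : IsSVD (R * R'ᵀ) U σ V) {g : Fin k → ℝ} (hg : ∀ j, g j ≠ 1 → σ j ≠ 0) :
    IsFactorization (Q * (U * diagonal g * Uᵀ * R)) Q (U * diagonal g * Uᵀ * R) where
  eq := rfl
  isometry := hA.isometry
  range := by
    obtain ⟨hU, hV, -, -, hM⟩ := h
    have hU' : U * Uᵀ = 1 := mul_eq_one_comm.mp hU
    have h1 : U * diagonal σ = R * R'ᵀ * V := by
      rw [hM, Matrix.mul_assoc, hV, Matrix.mul_one]
    have h2 : Qᵀ * Q * U * diagonal σ = U * diagonal σ := by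
      rw [Matrix.mul_assoc _ U, h1, Matrix.mul_assoc R, ← Matrix.mul_assoc _ R, hA.range]
    have h3 : Qᵀ * Q * U * diagonal (fun j => 1 - g j) = U * diagonal (fun j => 1 - g j) := by
      ext i j
      have := congrFun (congrFun h2 i) j
      simp only [Matrix.mul_diagonal] at this ⊢
      by_cases hj : g j = 1
      · simp [hj]
      · rw [mul_right_cancel₀ (hg j hj) this]
    have h4 : U * diagonal g * Uᵀ * R = R - U * diagonal (fun j => 1 - g j) * Uᵀ * R := by
      have : diagonal (fun j => 1 - g j) = 1 - diagonal g := by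
        rw [← Matrix.diagonal_one, Matrix.diagonal_sub]
      rw [this, Matrix.mul_sub, Matrix.sub_mul, Matrix.sub_mul, Matrix.mul_one, hU',
        Matrix.one_mul, sub_sub_cancel]
    rw [h4, Matrix.mul_sub, hA.range, ← Matrix.mul_assoc, ← Matrix.mul_assoc,
      ← Matrix.mul_assoc, h3]

/-- Removing one more direction `j` from `U diag(f) Uᵀ R` sets the entry `f j` to zero. -/
theorem deflate_step {k : ℕ} {U R : Matrix (Fin k) (Fin k) ℝ} (hU : Uᵀ * U = 1) (f : Fin k → ℝ)
    (j : Fin k) :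
    U * diagonal f * Uᵀ * R - vecMulVec (U.col j) ((U * diagonal f * Uᵀ * R)ᵀ *ᵥ U.col j) =
      U * diagonal (fun i => if i = j then 0 else f i) * Uᵀ * R := by
  have h1 : vecMulVec (U.col j) ((U * diagonal f * Uᵀ * R)ᵀ *ᵥ U.col j) =
      U * diagonal (Pi.single j 1) * Uᵀ * (U * diagonal f * Uᵀ * R) := by
    rw [Matrix.mulVec_transpose, ← Matrix.vecMulVec_mul]
    congr 1
    ext a b
    simp [vecMulVec_apply, Matrix.mul_apply, Matrix.diagonal_apply, Pi.single_apply]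
  have h2 : U * diagonal (Pi.single j 1) * Uᵀ * (U * diagonal f * Uᵀ * R) =
      U * (diagonal (Pi.single j 1) * diagonal f) * Uᵀ * R := by
    simp only [Matrix.mul_assoc]
    rw [← Matrix.mul_assoc Uᵀ U, hU, Matrix.one_mul]
  rw [h1, h2, Matrix.diagonal_mul_diagonal, ← Matrix.sub_mul, ← Matrix.sub_mul, ← Matrix.mul_sub,
    Matrix.diagonal_sub]
  congr 4
  ext i
  by_cases hij : i = j <;> simp [hij]

/-- The matrix `a bᵀ` of a snapshot. -/
def Snapshot.outer {dx dy : ℕ} (s : Snapshot dx dy) : Matrix (Fin dx) (Fin dy) ℝ :=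
  vecMulVec s.a s.b

open Classical in
/-- The registration of the singular directions with indices in `js`, where `f` records which
directions have been removed from `R₀` and `R₀'` before. -/
theorem register_foldlM_spec {dx dy k : ℕ} (θ : ℝ) (i : ℕ) {Q : Matrix (Fin dx) (Fin k) ℝ}
    {Q' : Matrix (Fin dy) (Fin k) ℝ} {R₀ R₀' U V : Matrix (Fin k) (Fin k) ℝ} {σ : Fin k → ℝ}
    (hU : Uᵀ * U = 1) (hV : Vᵀ * V = 1) (hσ : ∀ j, 0 ≤ σ j) (js : List (Fin k)) :
    ∀ (f : Fin k → ℝ) (p : Factors dx dy k × List (Snapshot dx dy)),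
      p.1 = ⟨Q * (U * diagonal f * Uᵀ * R₀), Q' * (V * diagonal f * Vᵀ * R₀'), Q,
        U * diagonal f * Uᵀ * R₀, Q', V * diagonal f * Vᵀ * R₀'⟩ →
      Comp.Spec (js.foldlM (fun p j => do
          charge 1
          if θ ≤ σ j then register i (σ j) (U.col j) (V.col j) p else pure p) p)
        fun p' n => ∃ g : Fin k → ℝ, (∀ j, g j = if j ∈ js ∧ θ ≤ σ j then 0 else f j) ∧
          p'.1 = ⟨Q * (U * diagonal g * Uᵀ * R₀), Q' * (V * diagonal g * Vᵀ * R₀'), Q,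
            U * diagonal g * Uᵀ * R₀, Q', V * diagonal g * Vᵀ * R₀'⟩ ∧
          ∃ L : List (Snapshot dx dy), p'.2 = p.2 ++ L ∧ (∀ s ∈ L, s.t = i) ∧
            L.length = (js.map fun j => if θ ≤ σ j then 1 else 0).sum ∧
            (L.map Snapshot.outer).sum = (js.map fun j => if θ ≤ σ j then
              σ j • vecMulVec ((Q * U).col j) ((Q' * V).col j) else 0).sum ∧
            n = js.length + L.length * (4 * (dx + dy) * k + 8 * k ^ 2 + 2 * (dx + dy) + 3) := by
  induction js with
  | nil =>
    intro f p hp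
    exact .pure ⟨f, by simp, hp, [], by simp⟩
  | cons j js ih =>
    intro f p hp
    rw [List.foldlM_cons]
    by_cases hj : θ ≤ σ j
    · obtain ⟨F, S⟩ := p
      dsimp only at hp
      subst hp
      refine .bind (P := fun p' n => ∃ s : Snapshot dx dy, s.t = i ∧
          s.outer = σ j • vecMulVec ((Q * U).col j) ((Q' * V).col j) ∧ p'.2 = S ++ [s] ∧
          p'.1 = ⟨Q * (U * diagonal (fun i => if i = j then 0 else f i) * Uᵀ * R₀),
            Q' * (V * diagonal (fun i => if i = j then 0 else f i) * Vᵀ * R₀'), Q,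
            U * diagonal (fun i => if i = j then 0 else f i) * Uᵀ * R₀, Q',
            V * diagonal (fun i => if i = j then 0 else f i) * Vᵀ * R₀'⟩ ∧
          n = 1 + (4 * (dx + dy) * k + 8 * k ^ 2 + 2 * (dx + dy) + 3)) ?_ ?_
      · refine .charge_bind ?_
        simp only [hj, ↓reduceIte]
        refine .mulVector_bind <| .mulVector_bind <| .mulVector_bind <| .mulVector_bind <|
          .charge_bind <| .charge_bind <| .pure ⟨_, rfl, ?_, rfl, ?_, ?_⟩
        · simp only [Snapshot.outer]
          rw [Matrix.smul_vecMulVec, Matrix.vecMulVec_smul, smul_smul, Real.mul_self_sqrt (hσ j)]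
          rfl
        · have h1 := deflate_step (R := R₀) hU f j
          have h2 := deflate_step (R := R₀') hV f j
          simp only [← h1, ← h2, Matrix.mul_sub, Matrix.mul_vecMulVec]
        · ring
      · rintro ⟨F', S'⟩ n ⟨s, hst, hso, hS', hF', rfl⟩
        dsimp only at hS' hF'
        subst hS'
        refine (ih _ ⟨F', _⟩ hF').mono ?_
        rintro p' m ⟨g, hg, hp', L, hL, hLt, hlen, hsum, rfl⟩
        refine ⟨g, fun a => ?_, hp', s :: L, by simp [hL], ?_, ?_, ?_, ?_⟩
        · rw [hg a]
          by_cases haj : a = j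
          · simp [haj, hj]
          · simp [haj]
        · simpa [hst] using hLt
        · simp [hlen, hj, add_comm]
        · simp [hsum, hj, hso]
        · simp only [List.length_cons]
          ring
    · refine .bind (P := fun p' n => p' = p ∧ n = 1) (.charge_bind ?_) ?_
      · simp only [hj, ↓reduceIte]
        exact .pure ⟨rfl, rfl⟩
      · rintro _ n ⟨rfl, rfl⟩
        refine (ih f _ hp).mono ?_
        rintro p' m ⟨g, hg, hp', L, hL, hLt, hlen, hsum, rfl⟩
        refine ⟨g, fun a => ?_, hp', L, hL, hLt, by simp [hlen, hj], by simp [hsum, hj], ?_⟩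
        · rw [hg a]
          by_cases haj : a = j
          · simp [haj, hj]
          · simp [haj]
        · simp only [List.length_cons]
          ring

/-! ### The registration phase -/

/-- The matrix `A Bᵀ` that a sketch represents, apart from its snapshots. -/
def Sketch.prod {dx dy : ℕ} (sk : Sketch dx dy) : Matrix (Fin dx) (Fin dy) ℝ :=
  sk.F.A * sk.F.Bᵀ

theorem mul_diagonal_mul_eq_sum {m n k : ℕ} (P : Matrix (Fin m) (Fin k) ℝ) (τ : Fin k → ℝ)
    (P' : Matrix (Fin n) (Fin k) ℝ) :
    P * diagonal τ * P'ᵀ = ∑ j, τ j • vecMulVec (P.col j) (P'.col j) := by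
  ext a b
  rw [Matrix.mul_apply, Matrix.sum_apply]
  refine Finset.sum_congr rfl fun j _ => ?_
  simp only [Matrix.mul_diagonal, Matrix.transpose_apply, Matrix.smul_apply, vecMulVec_apply,
    Matrix.col_apply, smul_eq_mul]
  ring

open Classical in
/-- The part of an update that registers snapshots: whatever leaves the sketch reappears in the
snapshots, each of which costs the sketch at least `θ` of its nuclear norm and `1` of its rank. -/
theorem registration_spec (κ : ℕ) {θ : ℝ} (hθ : 0 < θ) (i : ℕ) {dx dy k : ℕ}
    {F : Factors dx dy k} (hF : F.Valid) (S : List (Snapshot dx dy)) :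
    Comp.Spec (do
      let M ← mulMat F.RX F.RYᵀ
      let D ← svd κ M
      let p ← (List.finRange k).foldlM
        (fun p j => do
          charge 1
          if θ ≤ D.2.1 j then register i (D.2.1 j) (D.1.col j) (D.2.2.col j) p else pure p)
        (F, S)
      pure (⟨k, p.1, p.2⟩ : Sketch dx dy)) fun sk n =>
      sk.k = k ∧ sk.F.Valid ∧ ∃ L : List (Snapshot dx dy), sk.S = S ++ L ∧ (∀ s ∈ L, s.t = i) ∧
        F.A * F.Bᵀ = sk.prod + (L.map Snapshot.outer).sum ∧ ‖sk.prod‖ ≤ θ ∧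
        (∀ c, NuclearLE (F.A * F.Bᵀ) c → NuclearLE sk.prod (c - L.length * θ)) ∧
        sk.prod.rank + L.length ≤ (F.A * F.Bᵀ).rank ∧
        n ≤ (κ + 2) * k ^ 3 + k +
          L.length * (4 * (dx + dy) * k + 8 * k ^ 2 + 2 * (dx + dy) + 3) := by
  refine .mulMat_bind <| .bind (svd_spec κ _) ?_
  rintro ⟨U, σ, V⟩ n₁ ⟨hD, hn₁⟩
  dsimp only at hD ⊢
  have hU' : U * Uᵀ = 1 := mul_eq_one_comm.mp hD.1
  have hV' : V * Vᵀ = 1 := mul_eq_one_comm.mp hD.2.1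
  refine .bind (register_foldlM_spec θ i (Q := F.QX) (Q' := F.QY) (R₀ := F.RX) (R₀' := F.RY)
    hD.1 hD.2.1 hD.2.2.2.1 (List.finRange k) (fun _ => 1) (F, S) ?_) ?_
  · simp only [Matrix.diagonal_one, Matrix.mul_one, hU', hV', Matrix.one_mul]
    rw [← hF.1.eq, ← hF.2.eq]
  rintro ⟨F', S'⟩ n ⟨g, hg, hF', L, hS', hLt, hlen, hsum, rfl⟩
  dsimp only at hF' hS'
  subst hF' hS'
  have hdec := hF.1.isSingularDecomp hF.2 hD
  have hg' : ∀ j, g j = if θ ≤ σ j then 0 else 1 := by simpa using hg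
  have hg1 : ∀ j, g j ≠ 1 → σ j ≠ 0 := by
    intro j hj
    rw [hg'] at hj
    split_ifs at hj with h
    · exact (hθ.trans_le h).ne'
    · exact absurd rfl hj
  -- The singular values that stay in the sketch.
  let τ : Fin k → ℝ := fun j => if θ ≤ σ j then 0 else σ j
  have hτ0 : ∀ j, 0 ≤ τ j := fun j => by
    simp only [τ]
    split_ifs
    · exact le_rfl
    · exact hdec.nonneg j
  have hprod : F.QX * (U * diagonal g * Uᵀ * F.RX) * (F.QY * (V * diagonal g * Vᵀ * F.RY))ᵀ =
      F.QX * U * diagonal τ * (F.QY * V)ᵀ := by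
    have h1 : diagonal g * (Uᵀ * (F.RX * F.RYᵀ) * V) * diagonal g = diagonal τ := by
      have h2 : Uᵀ * (F.RX * F.RYᵀ) * V = Uᵀ * U * diagonal σ * (Vᵀ * V) := by
        rw [hD.2.2.2.2]
        simp only [Matrix.mul_assoc]
      rw [h2, hD.1, hD.2.1, Matrix.one_mul, Matrix.mul_one, Matrix.diagonal_mul_diagonal,
        Matrix.diagonal_mul_diagonal]
      congr 1
      ext j
      rw [hg']
      simp only [τ]
      split_ifs <;> simp
    rw [← h1]
    simp only [Matrix.transpose_mul, Matrix.diagonal_transpose, Matrix.transpose_transpose,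
      Matrix.mul_assoc]
  rw [← Fin.sum_univ_def] at hlen hsum
  have hrest : ∑ j, (σ j - τ j) • vecMulVec ((F.QX * U).col j) ((F.QY * V).col j) =
      (L.map Snapshot.outer).sum := by
    rw [hsum]
    refine Finset.sum_congr rfl fun j _ => ?_
    simp only [τ]
    split_ifs <;> simp
  refine .pure ⟨rfl, ⟨hF.1.deflate hD hg1, hF.2.deflate (R' := F.RX) (V := U) ?_ hg1⟩, L, rfl, hLt, ?_, ?_,
    ?_, ?_, ?_⟩
  · have := hD.transpose
    rwa [Matrix.transpose_mul, Matrix.transpose_transpose] at this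
  · simp only [Sketch.prod]
    rw [hprod, hdec.eq, mul_diagonal_mul_eq_sum, mul_diagonal_mul_eq_sum, ← hrest,
      ← Finset.sum_add_distrib]
    refine Finset.sum_congr rfl fun j _ => ?_
    rw [← add_smul, add_sub_cancel]
  · simp only [Sketch.prod]
    rw [hprod]
    refine hdec.norm_le hθ.le hτ0 fun j => ?_
    simp only [τ]
    split_ifs with h
    · exact hθ.le
    · exact (not_le.mp h).le
  · intro c hc
    simp only [Sketch.prod]
    rw [hprod]
    refine (hdec.nuclearLE hτ0).mono ?_
    have h1 := hdec.sum_le hc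
    have h2 : (L.length : ℝ) * θ ≤ ∑ j, (σ j - τ j) := by
      rw [hlen, Nat.cast_sum, Finset.sum_mul]
      refine Finset.sum_le_sum fun j _ => ?_
      simp only [τ]
      split_ifs with h
      · simpa using h
      · simp
    rw [Finset.sum_sub_distrib] at h2
    linarith
  · simp only [Sketch.prod]
    rw [hprod]
    refine le_trans ?_ hdec.card_le_rank
    refine (Nat.add_le_add_right (rank_mul_diagonal_mul_le _ _ _) _).trans ?_
    rw [hlen, ← Finset.card_filter, ← Finset.card_union_of_disjoint]
    · refine Finset.card_le_card fun j hj => ?_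
      simp only [Finset.mem_union, Finset.mem_filter, Finset.mem_univ, true_and, τ] at hj ⊢
      rcases hj with hj | hj
      · intro h0
        simp [h0] at hj
      · exact (hθ.trans_le hj).ne'
    · rw [Finset.disjoint_filter]
      intro j _ h1 h2
      simp [τ, h2] at h1
  · rw [List.length_finRange]
    nlinarith

/-! ### One update of one sketch -/

/-- The potential of a sketch in the amortized analysis. The number of columns pays for
compressions, the rank of `A Bᵀ` for registrations, and the length of the queue for removals. -/
noncomputable def Sketch.potential (κ l : ℕ) {dx dy : ℕ} (sk : Sketch dx dy) : ℕ :=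
  (6 * κ + 22) * ((dx + dy) * l) * sk.k + 18 * ((dx + dy) * l) * sk.prod.rank + sk.S.length

theorem expire_spec (N i : ℕ) {dx dy : ℕ} (S : List (Snapshot dx dy)) :
    (expire N i S).Spec fun S' n => S' = S.dropWhile (fun s => decide (s.t + N ≤ i)) ∧
      n + S'.length = S.length + 1 := by
  refine .charge_bind <| .pure ⟨rfl, ?_⟩
  have := (List.dropWhile_suffix (l := S) fun s => decide (s.t + N ≤ i)).length_le
  omega

theorem updateSketch_spec (κ l N : ℕ) {θ : ℝ} (hθ : 0 < θ) (i : ℕ) {dx dy : ℕ} (x : Fin dx → ℝ)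
    (y : Fin dy → ℝ) {sk : Sketch dx dy} (hF : sk.F.Valid) (hk : sk.k < l) (hx : l ≤ dx)
    (hy : l ≤ dy) :
    (updateSketch κ l N θ i x y sk).Spec fun sk' n => sk'.k < l ∧ sk'.F.Valid ∧
      (∃ (δ : ℝ) (L : List (Snapshot dx dy)), 0 ≤ δ ∧
        sk'.S = (sk.S.dropWhile fun s => decide (s.t + N ≤ i)) ++ L ∧ (∀ s ∈ L, s.t = i) ∧
        ‖sk.prod + vecMulVec x y - (sk'.prod + (L.map Snapshot.outer).sum)‖ ≤ δ ∧
        ‖sk'.prod‖ ≤ θ ∧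
        ∀ c, NuclearLE (sk.prod + vecMulVec x y) c →
          NuclearLE sk'.prod (c - l / 2 * δ - L.length * θ)) ∧
      n + sk'.potential κ l ≤
        sk.potential κ l + (6 * κ + 62) * ((dx + dy) * l + l ^ 3) := by
  refine .bind (expire_spec N i sk.S) ?_
  rintro S n₁ ⟨hS, hn₁⟩
  refine .bind (insert_spec κ l x y hF hk hx hy) ?_
  rintro ⟨c, G⟩ n₂ ⟨hc, hG, ⟨δ, hδ⟩, hn₂⟩
  dsimp only at hc hG hδ hn₂
  refine (registration_spec κ hθ i hG S).mono ?_
  rintro sk' n₃ ⟨hk', hF', L, hS', hLt, hprod, hnorm, hnuc, hrank, hn₃⟩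
  refine ⟨hk' ▸ hc, hF', ⟨δ, L, hδ.nonneg, hS ▸ hS', hLt, ?_, hnorm, fun c hc => ?_⟩, ?_⟩
  · rw [← hprod]
    exact hδ.error
  · exact hnuc _ (hδ.nuclear c hc)
  · have hrank' : sk'.prod.rank + L.length ≤ sk.prod.rank + 1 :=
      (hrank.trans hδ.rank).trans (rank_add_vecMulVec_le _ _ _)
    simp only [Sketch.potential]
    rw [hk', hS', List.length_append]
    set D := dx + dy with hD
    have hl1 : 1 ≤ l := by omega
    have hlD : l ≤ D := by omega
    have hDl : D ≤ D * l := Nat.le_mul_of_pos_right _ hl1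
    have hDc : D * c ≤ D * l := Nat.mul_le_mul_left _ hc.le
    have hcc : c ^ 2 ≤ D * l := by
      rw [sq]
      exact Nat.mul_le_mul (hc.le.trans hlD) hc.le
    have hc3 : (κ + 2) * c ^ 3 ≤ (κ + 2) * l ^ 3 := by gcongr
    have h1 : L.length * (4 * D * c + 8 * c ^ 2 + 2 * D + 3) + L.length ≤
        18 * (D * l) * L.length := by
      have : 4 * D * c + 8 * c ^ 2 + 2 * D + 3 + 1 ≤ 18 * (D * l) := by nlinarith
      calc _ = L.length * (4 * D * c + 8 * c ^ 2 + 2 * D + 3 + 1) := by ring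
        _ ≤ L.length * (18 * (D * l)) := Nat.mul_le_mul_left _ this
        _ = _ := by ring
    have h2 := Nat.mul_le_mul_left (18 * (D * l)) hrank'
    rw [mul_add, mul_add, mul_one] at h2
    have h3 : (6 * κ + 62) * (D * l + l ^ 3) = (6 * κ + 42) * (D * l) + 20 * (D * l) +
        ((κ + 2) * l ^ 3 + (5 * κ + 60) * l ^ 3) := by ring
    have h4 : 1 ≤ (5 * κ + 60) * l ^ 3 := Nat.mul_pos (by omega) (by positivity)
    omega

/-! ### The history of a sketch -/

/-- In a queue sorted by time, dropping the expired snapshots from the head removes all of them. -/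
theorem dropWhile_eq_filter_of_sorted {dx dy : ℕ} (c : ℕ) (N : ℕ) {S : List (Snapshot dx dy)}
    (hS : S.Pairwise fun s s' => s.t ≤ s'.t) :
    (S.dropWhile fun s => decide (s.t + N ≤ c)) = S.filter fun s => decide (c < s.t + N) := by
  induction S with
  | nil => rfl
  | cons s S ih =>
    rw [List.pairwise_cons] at hS
    by_cases h : s.t + N ≤ c
    · rw [List.dropWhile_cons_of_pos (by simpa using h), ih hS.2, List.filter_cons_of_neg]
      simpa using h
    · rw [List.dropWhile_cons_of_neg (by simpa using h), eq_comm, List.filter_eq_self]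
      intro s' hs'
      rw [decide_eq_true_eq]
      rcases List.mem_cons.mp hs' with rfl | hs'
      · exact not_le.mp h
      · have := hS.1 s' hs'
        omega

section
variable {dx dy : ℕ} (l N : ℕ) (θ : ℝ) (x : ℕ → EuclideanSpace ℝ (Fin dx))
  (y : ℕ → EuclideanSpace ℝ (Fin dy))

/-- The sum of the products `x t (y t)ᵀ` over the times `t` with `W < t ≤ T`. -/
noncomputable def streamSum (W T : ℕ) : Matrix (Fin dx) (Fin dy) ℝ :=
  ∑ t ∈ Finset.Ioc W T, vecMulVec (x t).ofLp (y t).ofLp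

/-- The invariant of a sketch at time `T` that was empty at time `T₀`. The list `L` holds all
snapshots ever registered and `Δ` is the accumulated error of the compressions. The matrix `P` is
the product of the sketch matrices at the earlier time `W`. -/
structure SketchInvariant (T₀ T : ℕ) (sk : Sketch dx dy) : Prop where
  k_lt : sk.k < l
  valid : sk.F.Valid
  norm_le : ‖sk.prod‖ ≤ θ
  le : T₀ ≤ T
  history : ∃ (L : List (Snapshot dx dy)) (Δ : ℝ), 0 ≤ Δ ∧
    sk.S = (L.filter fun s => decide (T < s.t + N)) ∧
    (L.Pairwise fun s s' => s.t ≤ s'.t) ∧ (∀ s ∈ L, s.t ≤ T) ∧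
    NuclearLE sk.prod (T - T₀ - l / 2 * Δ - L.length * θ) ∧
    ∀ W, T₀ ≤ W → W ≤ T → ∃ P : Matrix (Fin dx) (Fin dy) ℝ, ‖P‖ ≤ θ ∧
      ‖P + streamSum x y W T -
        (sk.prod + ((L.filter fun s => decide (W < s.t)).map Snapshot.outer).sum)‖ ≤ Δ

variable {l N θ x y}

theorem prod_empty : (Sketch.empty dx dy).prod = 0 := by
  rw [Sketch.prod]
  exact Matrix.zero_mul _

theorem SketchInvariant.empty (hl : 0 < l) (hθ : 0 ≤ θ) (T : ℕ) :
    SketchInvariant l N θ x y T T (Sketch.empty dx dy) where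
  k_lt := hl
  valid := by
    constructor <;> constructor <;> ext i j
    · exact j.elim0
    · exact j.elim0
    · exact j.elim0
    · exact j.elim0
    · exact j.elim0
    · exact j.elim0
  norm_le := by rw [prod_empty, norm_zero]; exact hθ
  le := le_rfl
  history := by
    refine ⟨[], 0, le_rfl, rfl, List.Pairwise.nil, by simp, ?_, fun W h1 h2 => ⟨0, ?_, ?_⟩⟩
    · rw [prod_empty]
      intro W _
      simp
    · rw [norm_zero]; exact hθ
    · obtain rfl : W = T := le_antisymm h2 h1
      simp [prod_empty, streamSum]

/-- The invariant passes from `T` to `T + 1`, given what `updateSketch_spec` says about the update: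
`δ` is the error of its compression and `L'` the list of its new snapshots. -/
theorem SketchInvariant.update (hN : 0 < N) {T₀ T : ℕ} {sk sk' : Sketch dx dy}
    (h : SketchInvariant l N θ x y T₀ T sk) (hx : ‖x (T + 1)‖ = 1) (hy : ‖y (T + 1)‖ = 1)
    (hk' : sk'.k < l) (hF' : sk'.F.Valid) {δ : ℝ} {L' : List (Snapshot dx dy)} (hδ : 0 ≤ δ)
    (hS' : sk'.S = (sk.S.dropWhile fun s => decide (s.t + N ≤ T + 1)) ++ L')
    (hL' : ∀ s ∈ L', s.t = T + 1)
    (herr : ‖sk.prod + vecMulVec (x (T + 1)).ofLp (y (T + 1)).ofLp -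
      (sk'.prod + (L'.map Snapshot.outer).sum)‖ ≤ δ)
    (hnorm : ‖sk'.prod‖ ≤ θ)
    (hnuc : ∀ c, NuclearLE (sk.prod + vecMulVec (x (T + 1)).ofLp (y (T + 1)).ofLp) c →
      NuclearLE sk'.prod (c - l / 2 * δ - L'.length * θ)) :
    SketchInvariant l N θ x y T₀ (T + 1) sk' := by
  obtain ⟨L, Δ, hΔ, hS, hL, hLT, hLnuc, hW⟩ := h.history
  refine ⟨hk', hF', hnorm, h.le.trans (Nat.le_succ T), L ++ L', Δ + δ, add_nonneg hΔ hδ, ?_, ?_, ?_,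
    ?_, ?_⟩
  · rw [hS', dropWhile_eq_filter_of_sorted _ _ (hS ▸ hL.filter _), hS, List.filter_filter,
      List.filter_append]
    congr 1
    · refine List.filter_congr fun s _ => ?_
      rw [← Bool.decide_and, decide_eq_decide]
      omega
    · rw [eq_comm, List.filter_eq_self]
      intro s hs
      rw [hL' s hs, decide_eq_true_eq]
      omega
  · rw [List.pairwise_append]
    refine ⟨hL, List.pairwise_of_forall_mem_list fun s hs s' hs' => ?_, fun s hs s' hs' => ?_⟩
    · rw [hL' s hs, hL' s' hs']
    · rw [hL' s' hs']
      exact (hLT s hs).trans (Nat.le_succ T)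
  · intro s hs
    rcases List.mem_append.mp hs with hs | hs
    · exact (hLT s hs).trans (Nat.le_succ T)
    · exact (hL' s hs).le
  · refine (hnuc _ (hLnuc.add_vecMulVec hx hy)).mono (le_of_eq ?_)
    rw [List.length_append]
    push_cast
    ring
  · intro W h1 h2
    rcases Nat.le_succ_iff.mp h2 with h2 | rfl
    · obtain ⟨P, hP, hPW⟩ := hW W h1 h2
      refine ⟨P, hP, ?_⟩
      have hf : (L'.filter fun s => decide (W < s.t)) = L' := by
        rw [List.filter_eq_self]
        intro s hs
        rw [hL' s hs, decide_eq_true_eq]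
        omega
      rw [List.filter_append, hf, List.map_append, List.sum_append, streamSum,
        Finset.sum_Ioc_succ_top h2]
      refine le_trans (le_of_eq ?_) ((norm_add_le _ _).trans (add_le_add hPW herr))
      congr 1
      rw [streamSum]
      abel
    · -- For `W = T + 1` there is nothing to account for yet.
      refine ⟨sk'.prod, hnorm, ?_⟩
      have hf : ((L ++ L').filter fun s => decide (T + 1 < s.t)) = [] := by
        rw [List.filter_eq_nil_iff]
        intro s hs
        rw [decide_eq_true_eq]
        rcases List.mem_append.mp hs with hs | hs
        · have := hLT s hs
          omega
        · have := hL' s hs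
          omega
      rw [Nat.succ_eq_add_one, hf]
      simpa [streamSum] using add_nonneg hΔ hδ

/-- A sketch that has lived for at most `2N` steps has at most `2 / ε` snapshots, as each of them
took `θ = ε N` from a nuclear norm that grows by at most one per step. -/
theorem SketchInvariant.length_le {ε : ℝ} (hN : 0 < N) (hε : 0 < ε) {T₀ T : ℕ} {sk : Sketch dx dy}
    (h : SketchInvariant l N (ε * N) x y T₀ T sk) (hT : T ≤ T₀ + 2 * N) :
    (sk.S.length : ℝ) ≤ 2 / ε := by
  obtain ⟨L, Δ, hΔ, hS, -, -, hnuc, -⟩ := h.history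
  have h0 := hnuc.nonneg
  have h1 : (sk.S.length : ℝ) ≤ L.length := by
    rw [hS]
    exact_mod_cast List.length_filter_le _ _
  have h2 : (T : ℝ) ≤ T₀ + 2 * N := by exact_mod_cast hT
  have hN' : (0 : ℝ) < N := by exact_mod_cast hN
  have h3 : 0 ≤ (l : ℝ) / 2 * Δ := by positivity
  refine h1.trans ?_
  rw [le_div_iff₀ hε]
  have h4 : (L.length * ε) * N ≤ 2 * N := by linarith
  exact le_of_mul_le_mul_right h4 hN'

/-- The error of a sketch on the current window: the compressions contribute at most `4 ε N`, and
what the sketch held at the beginning of the window at most `θ = ε N`. -/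
theorem SketchInvariant.window_error {ε : ℝ} (hN : 0 < N) (hε : 0 < ε) (hl : 1 / ε ≤ l) {T₀ T : ℕ}
    {sk : Sketch dx dy} (h : SketchInvariant l N (ε * N) x y T₀ T sk) (hT : T ≤ T₀ + 2 * N)
    (hT' : T₀ + N ≤ T) :
    ‖streamSum x y (T - N) T - (sk.prod + (sk.S.map Snapshot.outer).sum)‖ ≤ 5 * ε * N := by
  obtain ⟨L, Δ, hΔ, hS, -, -, hnuc, hW⟩ := h.history
  obtain ⟨P, hP, hPW⟩ := hW (T - N) (by omega) (by omega)
  have hf : (L.filter fun s => decide (T - N < s.t)) = sk.S := by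
    rw [hS]
    refine List.filter_congr fun s _ => ?_
    rw [decide_eq_decide]
    omega
  rw [hf] at hPW
  have h0 := hnuc.nonneg
  have h2 : (T : ℝ) ≤ T₀ + 2 * N := by exact_mod_cast hT
  have hN' : (0 : ℝ) < N := by exact_mod_cast hN
  have h3 : 0 ≤ (L.length : ℝ) * (ε * N) := by positivity
  have h4 : Δ / ε ≤ 4 * N := by
    have : 1 / ε * Δ ≤ l * Δ := mul_le_mul_of_nonneg_right hl hΔ
    rw [one_div_mul_eq_div] at this
    linarith
  rw [div_le_iff₀ hε] at h4
  have h5 : streamSum x y (T - N) T - (sk.prod + (sk.S.map Snapshot.outer).sum) =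
      P + streamSum x y (T - N) T - (sk.prod + (sk.S.map Snapshot.outer).sum) - P := by abel
  rw [h5]
  refine (norm_sub_le _ _).trans ((add_le_add hPW hP).trans ?_)
  linarith

/-! ### The whole data structure -/

variable (l N θ x y) in
/-- The invariant of the state at time `T`. The auxiliary sketch was started at time `Ta`, the last
multiple of `N` before `T`, and the primary sketch `N` steps earlier (both at time `0` if `Ta = 0`,
in agreement with truncated subtraction). -/
def StateInvariant (T : ℕ) (st : State dx dy) : Prop :=
  ∃ Ta, N ∣ Ta ∧ (Ta < T ∨ T = 0) ∧ T ≤ Ta + N ∧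
    SketchInvariant l N θ x y (Ta - N) T st.primary ∧ SketchInvariant l N θ x y Ta T st.aux

theorem run_spec (κ : ℕ) (hN : 0 < N) (hθ : 0 < θ) (hl : 0 < l) (hlx : l ≤ dx) (hly : l ≤ dy)
    (hx : ∀ t, 1 ≤ t → ‖x t‖ = 1) (hy : ∀ t, 1 ≤ t → ‖y t‖ = 1) (T : ℕ) :
    (run κ l N θ x y T).Spec fun st n => StateInvariant l N θ x y T st ∧
      n + (st.primary.potential κ l + st.aux.potential κ l) ≤
        T * ((12 * κ + 128) * ((dx + dy) * l + l ^ 3)) := by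
  have hempty : (Sketch.empty dx dy).potential κ l = 0 := by
    rw [Sketch.potential, prod_empty, Matrix.rank_zero]
    rfl
  induction T with
  | zero =>
    refine .pure ⟨⟨0, dvd_zero N, Or.inr rfl, Nat.zero_le _, ?_, SketchInvariant.empty hl hθ.le 0⟩,
      ?_⟩
    · rw [Nat.zero_sub]
      exact SketchInvariant.empty hl hθ.le 0
    · simp [State.init, hempty]
  | succ T ih =>
    refine .bind ih fun st n ⟨⟨Ta, hdvd, hlt, hle, hp, ha⟩, hn⟩ => .charge_bind ?_
    obtain ⟨st', hst', Ta', hdvd', hlt', hle', hp', ha', hpot⟩ : ∃ st' : State dx dy,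
        st' = (if T + 1 ≡ 1 [MOD N] then ⟨st.aux, Sketch.empty dx dy⟩ else st) ∧
        ∃ Ta', N ∣ Ta' ∧ Ta' < T + 1 ∧ T + 1 ≤ Ta' + N ∧
          SketchInvariant l N θ x y (Ta' - N) T st'.primary ∧
          SketchInvariant l N θ x y Ta' T st'.aux ∧
          st'.primary.potential κ l + st'.aux.potential κ l ≤
            st.primary.potential κ l + st.aux.potential κ l := by
      have hmod : T + 1 ≡ 1 [MOD N] ↔ N ∣ T := by
        rw [Nat.ModEq.comm, Nat.modEq_iff_dvd' (by omega), Nat.add_sub_cancel]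
      refine ⟨_, rfl, ?_⟩
      by_cases hT : N ∣ T
      · rw [if_pos (hmod.mpr hT)]
        refine ⟨T, hT, by omega, by omega, ?_, SketchInvariant.empty hl hθ.le T, ?_⟩
        · have : T - N = Ta := by
            rcases hlt with hlt | rfl
            · -- Both `T` and `Ta` are multiples of `N`, and `Ta < T ≤ Ta + N`.
              have := Nat.le_of_dvd (Nat.sub_pos_of_lt hlt) (Nat.dvd_sub hT hdvd)
              omega
            · have := ha.le
              omega
          rw [this]
          exact ha
        · dsimp only
          omega
      · rw [if_neg (mt hmod.mp hT)]
        have h1 : Ta ≤ T := ha.le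
        have h2 : T ≠ Ta + N := fun h => hT (h ▸ hdvd.add (dvd_refl N))
        exact ⟨Ta, hdvd, by omega, by omega, hp, ha, le_rfl⟩
    rw [← hst']
    refine .bind (updateSketch_spec κ l N hθ (T + 1) _ _ hp'.valid hp'.k_lt hlx hly) ?_
    rintro P n₁ ⟨hPk, hPF, ⟨δ, L, h1, h2, h3, h4, h5, h6⟩, hn₁⟩
    refine .bind (updateSketch_spec κ l N hθ (T + 1) _ _ ha'.valid ha'.k_lt hlx hly) ?_
    rintro Q n₂ ⟨hQk, hQF, ⟨δ', L', h1', h2', h3', h4', h5', h6'⟩, hn₂⟩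
    have hxT := hx (T + 1) (by omega)
    have hyT := hy (T + 1) (by omega)
    refine .pure ⟨⟨Ta', hdvd', Or.inl hlt', hle',
      hp'.update hN hxT hyT hPk hPF h1 h2 h3 h4 h5 h6,
      ha'.update hN hxT hyT hQk hQF h1' h2' h3' h4' h5' h6'⟩, ?_⟩
    dsimp only
    have hB : 1 ≤ (dx + dy) * l + l ^ 3 := by
      have : 0 < l ^ 3 := by positivity
      omega
    nlinarith

/-! ### Query and window -/

theorem Aaug_mul_Baug_transpose (st : State dx dy) :
    st.Aaug * st.Baugᵀ = st.primary.prod + (st.primary.S.map Snapshot.outer).sum := by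
  have h : (st.primary.S.map Snapshot.outer).sum =
      ∑ j : Fin st.primary.S.length, (st.primary.S.get j).outer := by
    rw [← List.sum_ofFn]
    congr 1
    exact (List.ofFn_getElem_eq_map _ _).symm
  ext i j
  rw [h, Matrix.add_apply, Matrix.sum_apply, Matrix.mul_apply]
  refine (Fin.sum_univ_add (fun c => st.Aaug i c * st.Baugᵀ c j)).trans ?_
  refine congrArg₂ (· + ·) (Finset.sum_congr rfl fun c _ => ?_) (Finset.sum_congr rfl fun c _ => ?_)
  · exact congrArg₂ (· * ·)
      (Fin.append_left (st.primary.F.A i) (fun j => (st.primary.S.get j).a i) c)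
      (Fin.append_left (st.primary.F.B j) (fun i => (st.primary.S.get i).b j) c)
  · exact congrArg₂ (· * ·)
      (Fin.append_right (st.primary.F.A i) (fun j => (st.primary.S.get j).a i) c)
      (Fin.append_right (st.primary.F.B j) (fun i => (st.primary.S.get i).b j) c)

theorem window_mul_window_transpose {T : ℕ} (hT : N ≤ T) :
    window x N T * (window y N T)ᵀ = streamSum x y (T - N) T := by
  ext i j
  have h : Finset.Ioc (T - N) T = Finset.Ico (T - N + 1) (T + 1) := by
    ext t
    simp only [Finset.mem_Ioc, Finset.mem_Ico]
    omega
  rw [streamSum, h, Finset.sum_Ico_eq_sum_range, show T + 1 - (T - N + 1) = N by omega,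
    Matrix.sum_apply, Matrix.mul_apply, Finset.sum_range]
  rfl

end

theorem frobNorm_window {d N : ℕ} {z : ℕ → EuclideanSpace ℝ (Fin d)}
    (hz : ∀ t, 1 ≤ t → ‖z t‖ = 1) (T : ℕ) : frobNorm (window z N T) = Real.sqrt N := by
  have h : ∀ j : Fin N, ∑ i, window z N T i j ^ 2 = 1 := fun j => by
    have h1 := EuclideanSpace.real_norm_sq_eq (z (T - N + 1 + j))
    rw [hz _ (by omega), one_pow] at h1
    exact h1.symm
  rw [frobNorm, Finset.sum_comm, Finset.sum_congr rfl fun j _ => h j]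
  simp

theorem sketchSize_le {ε : ℝ} (hε : 0 < ε) (hε1 : ε ≤ 1) (dx dy : ℕ) :
    (sketchSize ε dx dy : ℝ) ≤ 2 / ε := by
  have h1 : (sketchSize ε dx dy : ℝ) ≤ ⌈1 / ε⌉₊ := by
    exact_mod_cast min_le_left _ _
  have h2 := (Nat.ceil_lt_add_one (by positivity : 0 ≤ 1 / ε)).le
  have h3 : 1 ≤ 1 / ε := by rwa [le_div_iff₀ hε, one_mul]
  have h4 : 2 / ε = 1 / ε + 1 / ε := by ring
  linarith

theorem words_le {dx dy : ℕ} {ε : ℝ} (hε : 0 < ε) (hε1 : ε ≤ 1) {sk : Sketch dx dy}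
    (hk : (sk.k : ℝ) ≤ 2 / ε) (hkD : sk.k ≤ dx + dy) (hD : 1 ≤ dx + dy)
    (hS : (sk.S.length : ℝ) ≤ 2 / ε) : (sk.words : ℝ) ≤ 15 * ((dx + dy) / ε) := by
  rw [Sketch.words]
  push_cast
  have hD' : (1 : ℝ) ≤ dx + dy := by exact_mod_cast hD
  have hkD' : (sk.k : ℝ) ≤ dx + dy := by exact_mod_cast hkD
  set D : ℝ := dx + dy
  have h1 : D * sk.k ≤ 2 * (D / ε) := by
    calc D * sk.k ≤ D * (2 / ε) := by gcongr
      _ = 2 * (D / ε) := by ring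
  have h2 : (sk.k : ℝ) ^ 2 ≤ D * sk.k := by
    rw [sq]
    gcongr
  have h3 : 1 ≤ D / ε := by
    rw [le_div_iff₀ hε]
    linarith
  have h4 : (sk.S.length : ℝ) * (D + 2) ≤ 6 * (D / ε) := by
    calc (sk.S.length : ℝ) * (D + 2) ≤ 2 / ε * (3 * D) := by gcongr; linarith
      _ = 6 * (D / ε) := by ring
  linarith

end SOCOD

theorem mainTheorem1 (κ : ℕ) :
    ∃ C : ℝ, 0 < C ∧
      ∀ (dx dy N : ℕ) (ε : ℝ) (x : ℕ → EuclideanSpace ℝ (Fin dx))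
        (y : ℕ → EuclideanSpace ℝ (Fin dy)),
        0 < N → 0 < ε → ε ≤ 1 →
        (∀ t, 1 ≤ t → ‖x t‖ = 1) → (∀ t, 1 ≤ t → ‖y t‖ = 1) →
        (∀ T, ∃ st n, (SOCOD.run κ (SOCOD.sketchSize ε dx dy) N (ε * N) x y T).Returns st n) ∧
        ∀ T st n, (SOCOD.run κ (SOCOD.sketchSize ε dx dy) N (ε * N) x y T).Returns st n →
          (N ≤ T →
            (⌈1 / ε⌉₊ ≤ min dx dy →
              SOCOD.specNorm (SOCOD.window x N T * (SOCOD.window y N T).transpose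
                - st.Aaug * st.Baug.transpose) ≤ 8 * ε * N) ∧
            8 * ε * N =
              8 * ε * SOCOD.frobNorm (SOCOD.window x N T) *
                SOCOD.frobNorm (SOCOD.window y N T)) ∧
          (st.augCols : ℝ) ≤ C / ε ∧
          (st.primary.S.length : ℝ) ≤ C / ε ∧
          (st.aux.S.length : ℝ) ≤ C / ε ∧
          (st.words : ℝ) ≤ C * ((dx + dy) / ε) ∧
          (n : ℝ) ≤ C * T *
            ((dx + dy) * SOCOD.sketchSize ε dx dy + (SOCOD.sketchSize ε dx dy : ℝ) ^ 3) := by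
  refine ⟨12 * κ + 128, by positivity, fun dx dy N ε x y hN hε hε1 hx hy => ?_⟩
  set l := SOCOD.sketchSize ε dx dy with hl
  have hN' : (0 : ℝ) < N := by exact_mod_cast hN
  -- Unit vectors exist only in positive dimension.
  have hdx : 0 < dx := by
    rcases Nat.eq_zero_or_pos dx with rfl | h
    · have := hx 1 le_rfl
      rw [Subsingleton.elim (x 1) 0, norm_zero] at this
      exact absurd this zero_ne_one
    · exact h
  have hdy : 0 < dy := by
    rcases Nat.eq_zero_or_pos dy with rfl | h
    · have := hy 1 le_rfl
      rw [Subsingleton.elim (y 1) 0, norm_zero] at this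
      exact absurd this zero_ne_one
    · exact h
  have hl0 : 0 < l := lt_min (Nat.ceil_pos.mpr (by positivity)) (lt_min hdx hdy)
  have hlx : l ≤ dx := (min_le_right _ _).trans (min_le_left _ _)
  have hly : l ≤ dy := (min_le_right _ _).trans (min_le_right _ _)
  have hspec := SOCOD.run_spec (x := x) (y := y) κ hN (mul_pos hε hN') hl0 hlx hly hx hy
  refine ⟨fun T => (hspec T).1, fun T st n hr => ?_⟩
  obtain ⟨⟨Ta, -, hlt, hle, hp, ha⟩, hn⟩ := (hspec T).2 st n hr
  have hTa := ha.le
  have hSp := hp.length_le hN hε (by omega)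
  have hSa := ha.length_le hN hε (by omega)
  have hl2 : (l : ℝ) ≤ 2 / ε := SOCOD.sketchSize_le hε hε1 dx dy
  have hkp : (st.primary.k : ℝ) ≤ 2 / ε := le_trans (by exact_mod_cast hp.k_lt.le) hl2
  have hka : (st.aux.k : ℝ) ≤ 2 / ε := le_trans (by exact_mod_cast ha.k_lt.le) hl2
  have hC : ∀ c : ℝ, c ≤ 128 → c / ε ≤ (12 * κ + 128) / ε := fun c hc => by
    gcongr
    have : (0 : ℝ) ≤ 12 * κ := by positivity
    linarith
  refine ⟨fun hT => ⟨fun hmin => ?_, ?_⟩, ?_, hSp.trans (hC 2 (by norm_num)),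
    hSa.trans (hC 2 (by norm_num)), ?_, ?_⟩
  · have hlε : 1 / ε ≤ l := by
      rw [hl, SOCOD.sketchSize, min_eq_left hmin]
      exact Nat.le_ceil _
    rw [SOCOD.specNorm_eq_norm, SOCOD.window_mul_window_transpose hT,
      SOCOD.Aaug_mul_Baug_transpose]
    refine (hp.window_error hN hε hlε (by omega) (by omega)).trans ?_
    have := mul_pos hε hN'
    linarith
  · rw [SOCOD.frobNorm_window hx, SOCOD.frobNorm_window hy, mul_assoc (8 * ε),
      Real.mul_self_sqrt hN'.le]
  · refine le_trans ?_ (hC 4 (by norm_num))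
    rw [SOCOD.State.augCols]
    push_cast
    have : 4 / ε = 2 / ε + 2 / ε := by ring
    linarith
  · have h1 := SOCOD.words_le hε hε1 hkp (hp.k_lt.le.trans (hlx.trans (Nat.le_add_right _ _)))
      (by omega) hSp
    have h2 := SOCOD.words_le hε hε1 hka (ha.k_lt.le.trans (hlx.trans (Nat.le_add_right _ _)))
      (by omega) hSa
    rw [SOCOD.State.words]
    push_cast
    have hD : (1 : ℝ) ≤ dx + dy := by exact_mod_cast (by omega : 1 ≤ dx + dy)
    have h3 : 1 ≤ ((dx : ℝ) + dy) / ε := by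
      rw [le_div_iff₀ hε]
      linarith
    have h4 : 0 ≤ (12 * κ : ℝ) * (((dx : ℝ) + dy) / ε) := by positivity
    linarith
  · have h1 : n ≤ T * ((12 * κ + 128) * ((dx + dy) * l + l ^ 3)) := by omega
    have h2 : (n : ℝ) ≤ T * ((12 * κ + 128) * ((dx + dy) * l + l ^ 3)) := by exact_mod_cast h1
    linarith
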